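/- **Theorem 3.1.** Let $0<\alpha\le 1$, $p,q>0$, and let $g\in L^\infty(0,1)$ be real-valued with $g\ge 0$ a.e. Put $\mathcal D=H^2(0,1)\cap H^1_0(0,1)$ with the $H^2$ norm and $\mathcal L v=v''-g\,v$ for $v\in\mathcal D$, and let $\lambda_k$ $(k=1,2,\dots)$ be the eigenvalues of the problem $\mathcal L\omega=-\lambda\omega$, $0\ne\omega\in\mathcal D$ (they are all positive). Let $E_{\alpha,1}(z)=\sum_{n\ge0}z^n/\Gamma(\alpha n+1)$ and $$\Delta_k=E_{\alpha,1}(-\lambda_kq^\alpha)-\sqrt{\lambda_k}\,\sin(\sqrt{\lambda_k}\,p)-\cos(\sqrt{\lambda_k}\,p).$$ Write $(\cdot,\cdot)$ for the inner product of $L^2(0,1)$. For a function $v$ on $[0,q]$ with values in $L^2(0,1)$, continuously differentiable on $(0,q]$, let $D^\alpha v(t)=\frac1{\Gamma(1-\alpha)}\int_0^t(t-s)^{-\alpha}v'(s)\,ds$ for $0<t\le q$ be its Caputo derivative if $\alpha<1$, the integral being understood as $\lim_{\varepsilon\to0+}\int_\varepsilon^t$, and let $D^\alpha v=v'$ if $\alpha=1$.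 Given $\psi,\varphi\in\mathcal D$, *Problem 1* asks for a pair $(u,f)$ with $f\in L^2(0,1)$ and $u:[-p,q]\to\mathcal D$ such that (time derivatives being taken in $L^2(0,1)$, one-sidedly at the endpoints of the intervals $[-p,0]$ and $(0,q]$): 1. $u\in C([-p,q];\mathcal D)$; $u$ has a derivative $u_t$ on $[-p,0]$ and on $(0,q]$, continuous into $L^2(0,1)$ on each of these two intervals; $u_{tt}\in C((-p,0);L^2(0,1))$; $D^\alpha u$ exists on $(0,q]$ and extends to an element of $C([0,q];L^2(0,1))$, also denoted $D^\alpha u$; 2. $\lim_{t\to-p}\|u(t)-\psi\|_{\mathcal D}=0$ and $\lim_{t\to q}\|u(t)-\varphi\|_{\mathcal D}=0$; 3. $\lim_{\tau\to0+}\|D^\alpha u(\tau)-u_t(-\tau)\|_{L^2(0,1)}=0$; 4. $(D^\alpha u(t),\eta)-(\mathcal L u(t),\eta)=(f,\eta)$ for all $t\in[0,q]$ and all $\eta\in\mathcal D$; 5. $(u_{tt}(t),\eta)-(\mathcal L u(t),\eta)=(f,\eta)$ for all $t\in(-p,0)$ and all $\eta\in\mathcal D$. If $\Delta_k\neq0$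 for all $k$, then for any $\psi,\varphi\in\mathcal D$ Problem 1 has at most one solution: if $(u_1,f_1)$ and $(u_2,f_2)$ are solutions with the same data $\psi,\varphi$, then $u_1(t)=u_2(t)$ for all $t\in[-p,q]$ and $f_1=f_2$. -/

import Mathlib

open MeasureTheory Filter Topology Set
open scoped ENNReal ContDiff

noncomputable section

namespace MixedInverse

/-- The two-parameter Mittag-Leffler function `∑ zⁿ / Γ(αn + β)` at a real argument. -/
def mittagLeffler (α β z : ℝ) : ℝ :=
  ∑' n : ℕ, z ^ n / Real.Gamma (α * n + β)

/-- Lebesgue measure on the interval `(0, 1)`. -/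
abbrev unitMeasure : Measure ℝ := volume.restrict (Ioo (0 : ℝ) 1)

/-- The real Hilbert space `L²(0,1)`. -/
abbrev L2 : Type := Lp ℝ 2 unitMeasure

/-- The space `L^∞(0,1)`. -/
abbrev LInf : Type := Lp ℝ ∞ unitMeasure

/-- `v'` is the weak derivative of `v` on `(0,1)`: integration by parts against `C_c^∞(0,1)`. -/
def IsWeakDeriv (v v' : L2) : Prop :=
  ∀ η : ℝ → ℝ, ContDiff ℝ ∞ η → HasCompactSupport η → tsupport η ⊆ Ioo (0 : ℝ) 1 →
    ∫ x in Ioo (0 : ℝ) 1, v x * deriv η x = - ∫ x in Ioo (0 : ℝ) 1, v' x * η x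

/-- `v` has a representative which is continuous on `[0,1]` and vanishes at `0` and `1`. -/
def HasZeroTrace (v : L2) : Prop :=
  ∃ c : ℝ → ℝ, ContinuousOn c (Icc 0 1) ∧ c =ᵐ[unitMeasure] v ∧ c 0 = 0 ∧ c 1 = 0

theorem integrable_mul_test (v : L2) {η : ℝ → ℝ} (hη : Continuous η)
    (hc : HasCompactSupport η) : Integrable (fun x => v x * η x) unitMeasure := by
  have h1 : MemLp η 2 unitMeasure := hη.memLp_of_hasCompactSupport hc
  exact (Lp.memLp v).integrable_mul h1

theorem IsWeakDeriv.add {v v' w w' : L2} (hv : IsWeakDeriv v v') (hw : IsWeakDeriv w w') :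
    IsWeakDeriv (v + w) (v' + w') := by
  intro η h1 h2 h3
  have key : ∀ (a b : L2) (θ : ℝ → ℝ), Continuous θ → HasCompactSupport θ →
      ∫ x in Ioo (0 : ℝ) 1, (a + b : L2) x * θ x =
        (∫ x in Ioo (0 : ℝ) 1, a x * θ x) + ∫ x in Ioo (0 : ℝ) 1, b x * θ x := by
    intro a b θ hθ hc
    rw [← integral_add (integrable_mul_test a hθ hc) (integrable_mul_test b hθ hc)]
    refine integral_congr_ae ?_
    filter_upwards [Lp.coeFn_add a b] with x hx
    rw [hx, Pi.add_apply, add_mul]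
  rw [key v w _ (h1.continuous_deriv (by simp)) h2.deriv, key v' w' _ h1.continuous h2,
    hv η h1 h2 h3, hw η h1 h2 h3, neg_add]

theorem IsWeakDeriv.smul (r : ℝ) {v v' : L2} (hv : IsWeakDeriv v v') :
    IsWeakDeriv (r • v) (r • v') := by
  intro η h1 h2 h3
  have key : ∀ (a : L2) (θ : ℝ → ℝ),
      ∫ x in Ioo (0 : ℝ) 1, (r • a : L2) x * θ x = r * ∫ x in Ioo (0 : ℝ) 1, a x * θ x := by
    intro a θ
    rw [← integral_const_mul]
    refine integral_congr_ae ?_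
    filter_upwards [Lp.coeFn_smul r a] with x hx
    rw [hx, Pi.smul_apply, smul_eq_mul, mul_assoc]
  rw [key, key, hv η h1 h2 h3, mul_neg]

theorem IsWeakDeriv.zero : IsWeakDeriv 0 0 := by
  intro η h1 h2 h3
  have key : ∀ θ : ℝ → ℝ, ∫ x in Ioo (0 : ℝ) 1, (0 : L2) x * θ x = 0 := by
    intro θ
    refine integral_eq_zero_of_ae ?_
    filter_upwards [Lp.coeFn_zero ℝ 2 unitMeasure] with x hx
    rw [hx, Pi.zero_apply, zero_mul]
  rw [key, key, neg_zero]

theorem HasZeroTrace.add {v w : L2} (hv : HasZeroTrace v) (hw : HasZeroTrace w) :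
    HasZeroTrace (v + w) := by
  obtain ⟨c, hc, hcv, c0, c1⟩ := hv
  obtain ⟨d, hd, hdw, d0, d1⟩ := hw
  exact ⟨c + d, hc.add hd, (hcv.add hdw).trans (Lp.coeFn_add v w).symm,
    by simp [c0, d0], by simp [c1, d1]⟩

theorem HasZeroTrace.smul (r : ℝ) {v : L2} (hv : HasZeroTrace v) : HasZeroTrace (r • v) := by
  obtain ⟨c, hc, hcv, c0, c1⟩ := hv
  exact ⟨r • c, hc.const_smul r, (hcv.const_smul r).trans (Lp.coeFn_smul r v).symm,
    by simp [c0], by simp [c1]⟩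

theorem HasZeroTrace.zero : HasZeroTrace 0 :=
  ⟨0, continuousOn_const, (Lp.coeFn_zero ℝ 2 unitMeasure).symm, rfl, rfl⟩

/-- The space `H²(0,1) ∩ H¹₀(0,1)`. An element is stored as the triple `(v, v', v'')` of a function
and its first two weak derivatives, all in `L²(0,1)`, so that the norm inherited from the
`ℓ²`-product is the usual `H²` norm `(‖v‖² + ‖v'‖² + ‖v''‖²)^{1/2}`. -/
def domain : Submodule ℝ (PiLp 2 (fun _ : Fin 3 => L2)) where
  carrier := {v | IsWeakDeriv (v 0) (v 1) ∧ IsWeakDeriv (v 1) (v 2) ∧ HasZeroTrace (v 0)}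
  add_mem' := fun hv hw => ⟨hv.1.add hw.1, hv.2.1.add hw.2.1, hv.2.2.add hw.2.2⟩
  zero_mem' := ⟨IsWeakDeriv.zero, IsWeakDeriv.zero, HasZeroTrace.zero⟩
  smul_mem' := fun r _ hv => ⟨hv.1.smul r, hv.2.1.smul r, hv.2.2.smul r⟩

/-- The underlying `L²` function of an element of `H² ∩ H¹₀`. -/
def toL2 (v : domain) : L2 := (v : PiLp 2 (fun _ : Fin 3 => L2)) 0

/-- The weak second derivative of an element of `H² ∩ H¹₀`. -/
def secondDeriv (v : domain) : L2 := (v : PiLp 2 (fun _ : Fin 3 => L2)) 2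

/-- The operator `v ↦ v'' - g v` from `H² ∩ H¹₀` to `L²`; the dot is the pointwise product
`L^∞ × L² → L²`. -/
def sturmLiouville (g : LInf) (v : domain) : L2 :=
  secondDeriv v - (g • toL2 v : L2)

/-- `lam` is one of the eigenvalues of the problem `v'' - g v = -lam v`, `v(0) = v(1) = 0`. -/
def IsEigenvalue (g : LInf) (lam : ℝ) : Prop :=
  ∃ v : domain, toL2 v ≠ 0 ∧ sturmLiouville g v = -(lam • toL2 v)

/-- The quantity `E_{α,1}(-lam q^α) - √lam sin(√lam p) - cos(√lam p)`. -/
def discriminant (α p q lam : ℝ) : ℝ :=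
  mittagLeffler α 1 (-lam * q ^ α) - √lam * Real.sin (√lam * p) - Real.cos (√lam * p)

/-- `w` is the Caputo derivative of order `α ∈ (0,1]`, with initial point `0`, at the time `t > 0`
of a function whose derivative is `v'`: it is `v' t` for `α = 1`, and
`Γ(1-α)⁻¹ ∫₀ᵗ (t-s)^{-α} v'(s) ds` for `α < 1`. As `v'` need only be continuous on `(0, t]`, the
integral is understood as the limit of the integrals over `(ε, t)` as `ε → 0+`; it is the Bochner
integral over `(0,t)` whenever the latter exists. -/
def HasCaputoDeriv {E : Type*} [NormedAddCommGroup E] [NormedSpace ℝ E]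
    (α : ℝ) (v' : ℝ → E) (t : ℝ) (w : E) : Prop :=
  (α = 1 → w = v' t) ∧
  (α < 1 → Tendsto
    (fun ε : ℝ => (Real.Gamma (1 - α))⁻¹ • ∫ s in ε..t, (t - s) ^ (-α) • v' s)
    (𝓝[>] 0) (𝓝 w))

/-- The requirements on a solution `(u, f)` of the inverse problem with data `ψ` at `t = -p` and
`φ` at `t = q`, where `ut` is `∂u/∂t` (left derivative at `t = 0`), `utt` is `∂²u/∂t²` on
`(-p, 0)`, and `cu` is the Caputo derivative of `u` on `(0, q]`, extended continuously to `t = 0`.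
All time derivatives are taken in `L²(0,1)`. -/
structure SolvesWith (α p q : ℝ) (g : LInf) (ψ φ : domain) (u : ℝ → domain) (f : L2)
    (ut utt cu : ℝ → L2) : Prop where
  continuousOn_u : ContinuousOn u (Icc (-p) q)
  hasDeriv_neg : ∀ t ∈ Icc (-p) 0,
    HasDerivWithinAt (fun s => toL2 (u s)) (ut t) (Icc (-p) 0) t
  hasDeriv_pos : ∀ t ∈ Ioc 0 q,
    HasDerivWithinAt (fun s => toL2 (u s)) (ut t) (Ioc 0 q) t
  continuousOn_ut_neg : ContinuousOn ut (Icc (-p) 0)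
  continuousOn_ut_pos : ContinuousOn ut (Ioc 0 q)
  hasDeriv_ut : ∀ t ∈ Ioo (-p) 0, HasDerivAt ut (utt t) t
  continuousOn_utt : ContinuousOn utt (Ioo (-p) 0)
  hasCaputoDeriv : ∀ t ∈ Ioc 0 q, HasCaputoDeriv α ut t (cu t)
  continuousOn_cu : ContinuousOn cu (Icc 0 q)
  initial : Tendsto (fun t => ‖u t - ψ‖) (𝓝[>] (-p)) (𝓝 0)
  final : Tendsto (fun t => ‖u t - φ‖) (𝓝[<] q) (𝓝 0)
  gluing : Tendsto (fun τ => ‖cu τ - ut (-τ)‖) (𝓝[>] 0) (𝓝 0)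
  diffusion : ∀ t ∈ Icc 0 q, ∀ η : domain,
    inner ℝ (cu t) (toL2 η) - inner ℝ (sturmLiouville g (u t)) (toL2 η) = inner ℝ f (toL2 η)
  wave : ∀ t ∈ Ioo (-p) 0, ∀ η : domain,
    inner ℝ (utt t) (toL2 η) - inner ℝ (sturmLiouville g (u t)) (toL2 η) = inner ℝ f (toL2 η)

/-- The pair `(u, f)` is a weak solution of the inverse source problem. Only the values of `u` on
`[-p, q]` matter. -/
def IsSolution (α p q : ℝ) (g : LInf) (ψ φ : domain) (u : ℝ → domain) (f : L2) : Prop :=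
  ∃ ut utt cu : ℝ → L2, SolvesWith α p q g ψ φ u f ut utt cu

end MixedInverse

end

/-! Everything is tested against a single eigenfunction `e` with eigenvalue λ > 0. Put y(t) = (u(t),
e) and c = (f, e). For t > 0 the equation reads D^α y = c - λy, so y = c/λ + A·E_{α,1}(-λt^α) with A
= y(0) - c/λ. For t < 0 it reads y'' = c - λy, and gluing forces y'(0-) = c - λy(0) = -λA, so y =
c/λ + A(cos √λt - √λ sin √λt). Subtracting the values at -p and q removes c/λ and leaves AΔ = (φ -
ψ, e). Since Δ ≠ 0, the data determine A, then c from y(q), then y. No series expansion of u is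
needed, only that no nonzero L² function is orthogonal to every such `e`.

That completeness (`exists_eigenfunction_inner_ne_zero`) is the spectral theorem for the inverse of
-𝓛. An element v of H¹₀ is encoded by its mean-zero derivative w, with v = `volterra w`; Lax-Milgram
gives the inverse, and it is compact because the Volterra operator is.

The delicate point for t > 0 is that u_t may fail to be integrable at 0, the Caputo integral being
only a limit. `sub_eq_of_hasCaputoDeriv` nevertheless recovers y from D^α y: cut off at ε, invert by
Abel, and bound the missing piece by the oscillation of y on [0, ε]. Iterating the resulting
Volterra equation produces the Mittag-Leffler series. -/

noncomputable section

namespace MixedInverse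

/-! ### Lax-Milgram for a form with a compact embedding -/

section FormResolvent

variable {V H : Type*} [NormedAddCommGroup V] [InnerProductSpace ℝ V] [CompleteSpace V]
  [NormedAddCommGroup H] [InnerProductSpace ℝ H] [CompleteSpace H]

/-- The solution operator of the variational problem `⟪w, z⟫ + ⟪M J w, J z⟫ = ⟪h, J z⟫`, seen as
the map `h ↦ J w`. -/
theorem exists_form_resolvent (J : V →L[ℝ] H) (hJ : IsCompactOperator J) (M : H →L[ℝ] H)
    (hM : ∀ x y, inner ℝ (M x) y = inner ℝ x (M y)) (hM0 : ∀ x, 0 ≤ inner ℝ (M x) x) :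
    ∃ T : H →L[ℝ] H, IsCompactOperator T ∧ (T : H →ₗ[ℝ] H).IsSymmetric ∧
      (∀ h, 0 ≤ inner ℝ (T h) h) ∧
      ∀ h, ∃ w, T h = J w ∧
        (∀ z, inner ℝ w z + inner ℝ (M (J w)) (J z) = inner ℝ h (J z)) ∧
        ∀ w', (∀ z, inner ℝ w' z + inner ℝ (M (J w')) (J z) = inner ℝ h (J z)) → w' = w := by
  let A : V →L[ℝ] V := ContinuousLinearMap.id ℝ V + J.adjoint ∘L M ∘L J
  have hA : ∀ w z, inner ℝ (A w) z = inner ℝ w z + inner ℝ (M (J w)) (J z) := fun w z => by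
    simp [A, inner_add_left, ContinuousLinearMap.adjoint_inner_left]
  let B : V →L[ℝ] V →L[ℝ] ℝ := (innerSL ℝ (E := V)) ∘L A
  have hBA : ∀ w z, B w z = inner ℝ (A w) z := fun w z => rfl
  -- The constant 1 works because `M` is nonnegative.
  have hB : IsCoercive B := ⟨1, one_pos, fun w => by
    rw [hBA, hA, real_inner_self_eq_norm_mul_norm, one_mul]
    linarith [hM0 (J w)]⟩
  let R := hB.continuousLinearEquivOfBilin
  have hR : ∀ w z, inner ℝ (R w) z = inner ℝ w z + inner ℝ (M (J w)) (J z) := fun w z => by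
    rw [← hA, ← hBA]; exact hB.continuousLinearEquivOfBilin_apply w z
  have hw : ∀ h z, inner ℝ (R.symm (J.adjoint h)) z
      + inner ℝ (M (J (R.symm (J.adjoint h)))) (J z) = inner ℝ h (J z) := fun h z => by
    rw [← hR, R.apply_symm_apply, ContinuousLinearMap.adjoint_inner_left]
  refine ⟨J ∘L (R.symm : V →L[ℝ] V) ∘L J.adjoint, ?_, ?_, ?_, ?_⟩
  · exact hJ.comp_clm ((R.symm : V →L[ℝ] V) ∘L J.adjoint)
  · intro h k
    change inner ℝ (J (R.symm (J.adjoint h))) k = inner ℝ h (J (R.symm (J.adjoint k)))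
    -- Both sides are the symmetric form evaluated at the two solutions.
    rw [real_inner_comm, ← hw k, ← hw h, hM, real_inner_comm (R.symm (J.adjoint h)),
      real_inner_comm (M (J (R.symm (J.adjoint h))))]
  · intro h
    change 0 ≤ inner ℝ (J (R.symm (J.adjoint h))) h
    rw [real_inner_comm, ← hw h]
    exact add_nonneg real_inner_self_nonneg (hM0 _)
  · intro h
    refine ⟨R.symm (J.adjoint h), rfl, hw h, fun w' hw' => ?_⟩
    rw [ContinuousLinearEquiv.eq_symm_apply]
    refine ext_inner_right ℝ fun z => ?_
    rw [hR, hw', ContinuousLinearMap.adjoint_inner_left]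

end FormResolvent

/-! ### The Volterra operator on `L²(0,1)` -/

theorem integrable_unit (w : L2) : Integrable w unitMeasure :=
  (Lp.memLp w).integrable (by norm_num)

/-- The primitive of an `L²` function which vanishes at `0`, constant outside `(0,1)`. -/
def primitive (w : L2) (x : ℝ) : ℝ := ∫ y in (0 : ℝ)..x, w y ∂unitMeasure

theorem continuous_primitive (w : L2) : Continuous (primitive w) :=
  intervalIntegral.continuous_primitive (fun _ _ => (integrable_unit w).intervalIntegrable) 0

theorem primitive_zero_right (w : L2) : primitive w 0 = 0 := by simp [primitive]

theorem primitive_one (w : L2) : primitive w 1 = ∫ x, w x ∂unitMeasure := by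
  rw [primitive, intervalIntegral.integral_of_le zero_le_one,
    Measure.restrict_restrict measurableSet_Ioc, inter_eq_self_of_subset_right Ioo_subset_Ioc_self]

/-- Cauchy-Schwarz against the indicator of `(a, b]`. This Hölder bound is the source of both the
boundedness and the compactness of the Volterra operator. -/
theorem abs_primitive_sub_le (w : L2) {a b : ℝ} (hab : a ≤ b) :
    |primitive w b - primitive w a| ≤ √(b - a) * ‖w‖ := by
  have hfin : unitMeasure (Ioc a b) ≠ ⊤ := measure_ne_top _ _
  have h1 : primitive w b - primitive w a
      = inner ℝ (indicatorConstLp 2 measurableSet_Ioc hfin (1 : ℝ)) w := by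
    rw [L2.inner_indicatorConstLp_one, primitive, primitive,
      intervalIntegral.integral_interval_sub_left (integrable_unit w).intervalIntegrable
      (integrable_unit w).intervalIntegrable, intervalIntegral.integral_of_le hab]
  rw [h1]
  refine (abs_real_inner_le_norm _ _).trans ?_
  gcongr
  rw [norm_indicatorConstLp (by norm_num) (by norm_num), norm_one, one_mul, Real.sqrt_eq_rpow]
  simp only [ENNReal.toReal_ofNat]
  gcongr
  rw [← Real.volume_real_Ioc_of_le hab]
  exact ENNReal.toReal_mono (by simp) (Measure.restrict_apply_le _ _)

theorem abs_primitive_le (w : L2) {x : ℝ} (hx : x ∈ Icc (0 : ℝ) 1) : |primitive w x| ≤ ‖w‖ := by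
  have h := abs_primitive_sub_le w hx.1
  rw [primitive_zero_right, sub_zero, sub_zero] at h
  refine h.trans (mul_le_of_le_one_left (norm_nonneg _) ?_)
  exact Real.sqrt_le_one.mpr hx.2

theorem ae_mem_unit : ∀ᵐ x ∂unitMeasure, x ∈ Ioo (0 : ℝ) 1 := ae_restrict_mem measurableSet_Ioo

theorem memLp_primitive (w : L2) : MemLp (primitive w) 2 unitMeasure := by
  refine MemLp.of_bound (continuous_primitive w).aestronglyMeasurable ‖w‖ ?_
  filter_upwards [ae_mem_unit] with x hx using abs_primitive_le w (Ioo_subset_Icc_self hx)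

theorem primitive_add (v w : L2) : primitive (v + w) = primitive v + primitive w := by
  funext x
  rw [Pi.add_apply, primitive, primitive, primitive,
    ← intervalIntegral.integral_add (integrable_unit v).intervalIntegrable
      (integrable_unit w).intervalIntegrable]
  refine intervalIntegral.integral_congr_ae ?_
  filter_upwards [Lp.coeFn_add v w] with y hy _ using hy

theorem primitive_smul (c : ℝ) (w : L2) : primitive (c • w) = c • primitive w := by
  funext x
  rw [Pi.smul_apply, primitive, primitive, ← intervalIntegral.integral_smul]
  refine intervalIntegral.integral_congr_ae ?_
  filter_upwards [Lp.coeFn_smul c w] with y hy _ using hy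

/-- The measure has total mass 1, so the L² norm is at most the essential supremum. -/
theorem norm_unit_le {w : L2} {C : ℝ} (hC : 0 ≤ C) (h : ∀ᵐ x ∂unitMeasure, ‖w x‖ ≤ C) :
    ‖w‖ ≤ C := by
  refine (Lp.norm_le_of_ae_bound hC h).trans_eq ?_
  simp [measureUnivNNReal]

/-- The Volterra operator `w ↦ ∫₀ˣ w` on `L²(0,1)`. -/
def volterra : L2 →L[ℝ] L2 :=
  LinearMap.mkContinuous
    { toFun := fun w => (memLp_primitive w).toLp (primitive w)
      map_add' := fun v w => by
        rw [← MemLp.toLp_add]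
        exact MemLp.toLp_congr _ _ (by rw [primitive_add])
      map_smul' := fun c w => by
        rw [RingHom.id_apply, ← MemLp.toLp_const_smul]
        exact MemLp.toLp_congr _ _ (by rw [primitive_smul]) } 1
    (fun w => by
      rw [one_mul]
      refine norm_unit_le (norm_nonneg _) ?_
      filter_upwards [ae_mem_unit, (memLp_primitive w).coeFn_toLp] with x hx hx'
      rw [LinearMap.coe_mk, AddHom.coe_mk, hx']
      exact abs_primitive_le w (Ioo_subset_Icc_self hx))

theorem coeFn_volterra (w : L2) : volterra w =ᵐ[unitMeasure] primitive w :=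
  (memLp_primitive w).coeFn_toLp

theorem inner_eq_integral (v w : L2) : inner ℝ v w = ∫ x, v x * w x ∂unitMeasure := by
  rw [L2.inner_def]
  simp [mul_comm]

/-- Integration by parts for primitives. -/
theorem inner_volterra_add (v w : L2) :
    inner ℝ (volterra v) w + inner ℝ v (volterra w)
      = (∫ x, v x ∂unitMeasure) * ∫ x, w x ∂unitMeasure := by
  have hv := integrable_unit v
  have hw := integrable_unit w
  have hprod : Integrable (fun z : ℝ × ℝ => v z.1 * w z.2) (unitMeasure.prod unitMeasure) :=
    hv.mul_prod hw
  -- Fubini on the unit square: the diagonal cuts it into two triangles, one for each inner product.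
  set S : Set (ℝ × ℝ) := {z | z.1 ≤ z.2} with hS
  have hSm : MeasurableSet S := measurableSet_le measurable_fst measurable_snd
  have prim : ∀ (u : L2) {x : ℝ}, x ∈ Ioo (0 : ℝ) 1 →
      primitive u x = ∫ y in Iic x, u y ∂unitMeasure := by
    intro u x hx
    rw [primitive, intervalIntegral.integral_of_le hx.1.le,
      Measure.restrict_restrict measurableSet_Ioc, Measure.restrict_restrict measurableSet_Iic]
    congr 2
    ext y
    simp only [mem_inter_iff, mem_Ioc, mem_Ioo, mem_Iic]
    tauto
  have h1 : inner ℝ (volterra v) w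
      = ∫ z, S.indicator (fun z : ℝ × ℝ => v z.1 * w z.2) z ∂(unitMeasure.prod unitMeasure) := by
    rw [integral_prod_symm _ (hprod.indicator hSm), inner_eq_integral]
    refine integral_congr_ae ?_
    filter_upwards [coeFn_volterra v, ae_mem_unit] with x hx hx'
    rw [hx, prim v hx', ← integral_mul_const, ← integral_indicator measurableSet_Iic]
    rfl
  have h2 : inner ℝ v (volterra w)
      = ∫ z, Sᶜ.indicator (fun z : ℝ × ℝ => v z.1 * w z.2) z ∂(unitMeasure.prod unitMeasure) := by
    rw [integral_prod _ (hprod.indicator hSm.compl), inner_eq_integral]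
    refine integral_congr_ae ?_
    filter_upwards [coeFn_volterra w, ae_mem_unit] with x hx hx'
    rw [hx, prim w hx', integral_Iic_eq_integral_Iio, ← integral_const_mul,
      ← integral_indicator measurableSet_Iio]
    refine integral_congr_ae (Eventually.of_forall fun y => ?_)
    simp only [indicator, mem_Iio, hS, mem_compl_iff, mem_ofPred_eq, not_le]
  rw [h1, h2, ← integral_add (hprod.indicator hSm) (hprod.indicator hSm.compl),
    ← integral_prod_mul]
  refine integral_congr_ae (Eventually.of_forall fun z => ?_)
  exact indicator_self_add_compl_apply S _ z

/-- The step function with value `c k` on `[k/(n+1), (k+1)/(n+1))`. -/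
def stepFun (n : ℕ) (c : Fin (n + 1) → ℝ) (x : ℝ) : ℝ := c (Fin.ofNat (n + 1) ⌊(n + 1) * x⌋₊)

theorem memLp_stepFun (n : ℕ) (c : Fin (n + 1) → ℝ) : MemLp (stepFun n c) 2 unitMeasure := by
  refine MemLp.of_bound (Measurable.aestronglyMeasurable ?_) ‖c‖
    (Eventually.of_forall fun x => norm_le_pi_norm c _)
  have : Measurable fun k : ℕ => c (Fin.ofNat (n + 1) k) := measurable_from_nat
  exact this.comp (Nat.measurable_floor.comp (measurable_const.mul measurable_id))

/-- The step function with given values, as an element of `L²(0,1)`. -/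
def stepMap (n : ℕ) : (Fin (n + 1) → ℝ) →L[ℝ] L2 :=
  LinearMap.toContinuousLinearMap
    { toFun := fun c => (memLp_stepFun n c).toLp
      map_add' := fun _ _ => by
        rw [← MemLp.toLp_add]; rfl
      map_smul' := fun _ _ => by
        rw [RingHom.id_apply, ← MemLp.toLp_const_smul]; rfl }

theorem coeFn_stepMap (n : ℕ) (c : Fin (n + 1) → ℝ) :
    stepMap n c =ᵐ[unitMeasure] stepFun n c :=
  (memLp_stepFun n c).coeFn_toLp

/-- The values of a primitive at the points `k/(n+1)`. -/
def samplePrimitive (n : ℕ) : L2 →L[ℝ] (Fin (n + 1) → ℝ) :=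
  ContinuousLinearMap.pi fun k => LinearMap.mkContinuous
    { toFun := fun w => primitive w ((k : ℕ) / (n + 1 : ℝ))
      map_add' := fun v w => by rw [primitive_add]; rfl
      map_smul' := fun c w => by rw [primitive_smul]; rfl } 1 fun w => by
    rw [one_mul]
    refine abs_primitive_le w ⟨by positivity, ?_⟩
    rw [div_le_one (by positivity)]
    exact_mod_cast k.2.le

/-- The primitive is replaced by its value at the left end of a cell of length `1/(n+1)`; the Hölder
bound controls the change. -/
theorem norm_volterra_sub_step_le (n : ℕ) :
    ‖volterra - stepMap n ∘L samplePrimitive n‖ ≤ √(1 / (n + 1 : ℝ)) := by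
  refine ContinuousLinearMap.opNorm_le_bound _ (Real.sqrt_nonneg _) fun w => ?_
  refine norm_unit_le (by positivity) ?_
  rw [sub_apply, ContinuousLinearMap.comp_apply]
  filter_upwards [Lp.coeFn_sub (volterra w) (stepMap n (samplePrimitive n w)), coeFn_volterra w,
    coeFn_stepMap n (samplePrimitive n w), ae_mem_unit] with x h1 h2 h3 hx
  have hn : (0 : ℝ) < n + 1 := by positivity
  -- On `(0, 1)` the reduction modulo `n + 1` hidden in `stepFun` is therefore harmless.
  have hk : ⌊(n + 1 : ℝ) * x⌋₊ < n + 1 := by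
    rw [Nat.floor_lt (by nlinarith [hx.1])]
    push_cast
    nlinarith [hx.2]
  have hs : stepFun n (samplePrimitive n w) x
      = primitive w ((⌊(n + 1 : ℝ) * x⌋₊ : ℝ) / (n + 1)) := by
    change primitive w (((Fin.ofNat (n + 1) ⌊(n + 1 : ℝ) * x⌋₊ : Fin (n + 1)) : ℕ) / (n + 1 : ℝ)) = _
    rw [Fin.val_ofNat, Nat.mod_eq_of_lt hk]
  rw [h1, Pi.sub_apply, h2, h3, hs, Real.norm_eq_abs]
  have hle : (⌊(n + 1 : ℝ) * x⌋₊ : ℝ) / (n + 1) ≤ x := by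
    rw [div_le_iff₀ hn, mul_comm x]
    exact Nat.floor_le (by nlinarith [hx.1])
  refine (abs_primitive_sub_le w hle).trans ?_
  gcongr
  have := Nat.lt_floor_add_one ((n + 1 : ℝ) * x)
  rw [sub_le_iff_le_add, ← add_div, le_div_iff₀ hn]
  linarith

/-- A norm limit of operators that factor through a finite-dimensional space. -/
theorem isCompactOperator_volterra : IsCompactOperator volterra := by
  refine isCompactOperator_of_tendsto (l := atTop)
    (F := fun n => stepMap n ∘L samplePrimitive n) ?_ (Eventually.of_forall fun n => ?_)
  · rw [tendsto_iff_norm_sub_tendsto_zero]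
    refine squeeze_zero (fun _ => norm_nonneg _)
      (fun n => (norm_sub_rev _ _).trans_le (norm_volterra_sub_step_le n)) ?_
    have := (Real.continuous_sqrt.tendsto 0).comp
      (tendsto_one_div_add_atTop_nhds_zero_nat (𝕜 := ℝ))
    rwa [Real.sqrt_zero] at this
  · have h : IsCompactOperator (samplePrimitive n) :=
      isCompactOperator_of_locallyCompactSpace_dom (samplePrimitive n)
    exact h.clm_comp (stepMap n)

/-! ### Test functions and weak derivatives -/

/-- `η ∈ C_c^∞(0,1)`. -/
structure IsTest (η : ℝ → ℝ) : Prop where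
  contDiff : ContDiff ℝ ∞ η
  hasCompactSupport : HasCompactSupport η
  tsupport_subset : tsupport η ⊆ Ioo (0 : ℝ) 1

theorem IsTest.isTest_deriv {η : ℝ → ℝ} (h : IsTest η) : IsTest (deriv η) where
  contDiff := (contDiff_infty_iff_deriv.mp h.contDiff).2
  hasCompactSupport := h.hasCompactSupport.deriv
  tsupport_subset := tsupport_deriv_subset.trans h.tsupport_subset

theorem IsTest.memLp {η : ℝ → ℝ} (h : IsTest η) : MemLp η 2 unitMeasure :=
  h.contDiff.continuous.memLp_of_hasCompactSupport h.hasCompactSupport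

theorem IsTest.integrable {η : ℝ → ℝ} (h : IsTest η) : Integrable η unitMeasure :=
  h.memLp.integrable (by norm_num)

/-- A test function as an element of `L²(0,1)`. -/
def IsTest.toL2 {η : ℝ → ℝ} (h : IsTest η) : L2 := h.memLp.toLp η

theorem IsTest.coeFn_toL2 {η : ℝ → ℝ} (h : IsTest η) : h.toL2 =ᵐ[unitMeasure] η :=
  h.memLp.coeFn_toLp

theorem IsTest.inner_toL2 {η : ℝ → ℝ} (h : IsTest η) (v : L2) :
    inner ℝ v h.toL2 = ∫ x in Ioo (0 : ℝ) 1, v x * η x := by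
  rw [inner_eq_integral]
  refine integral_congr_ae ?_
  filter_upwards [h.coeFn_toL2] with x hx
  rw [hx]

theorem IsTest.apply_eq_zero {η : ℝ → ℝ} (h : IsTest η) {x : ℝ} (hx : x ∉ Ioo (0 : ℝ) 1) :
    η x = 0 :=
  image_eq_zero_of_notMem_tsupport fun hx' => hx (h.tsupport_subset hx')

theorem setIntegral_Ioo_eq_intervalIntegral (f : ℝ → ℝ) :
    ∫ x in Ioo (0 : ℝ) 1, f x = ∫ x in (0 : ℝ)..1, f x := by
  rw [intervalIntegral.integral_of_le zero_le_one, integral_Ioc_eq_integral_Ioo]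

theorem primitive_eq_intervalIntegral {w : L2} {f : ℝ → ℝ} (h : w =ᵐ[unitMeasure] f) {x : ℝ}
    (hx : x ∈ Ioo (0 : ℝ) 1) : primitive w x = ∫ y in (0 : ℝ)..x, f y := by
  rw [primitive, intervalIntegral.integral_congr_ae (h.mono fun y hy _ => hy),
    intervalIntegral.integral_of_le hx.1.le, intervalIntegral.integral_of_le hx.1.le,
    Measure.restrict_restrict measurableSet_Ioc, inter_eq_self_of_subset_left]
  exact fun y hy => ⟨hy.1, hy.2.trans_lt hx.2⟩

theorem IsTest.volterra_deriv {η : ℝ → ℝ} (h : IsTest η) : volterra h.isTest_deriv.toL2 = h.toL2 := by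
  refine Lp.ext ?_
  filter_upwards [coeFn_volterra h.isTest_deriv.toL2, h.coeFn_toL2, ae_mem_unit] with x h1 h2 hx
  rw [h1, h2, primitive_eq_intervalIntegral h.isTest_deriv.coeFn_toL2 hx,
    intervalIntegral.integral_deriv_eq_sub, h.apply_eq_zero (x := 0) (by simp), sub_zero]
  · exact fun y _ => (h.contDiff.differentiable (by simp)).differentiableAt
  · exact h.isTest_deriv.contDiff.continuous.intervalIntegrable _ _

theorem IsTest.integral_deriv_toL2 {η : ℝ → ℝ} (h : IsTest η) :
    ∫ x, h.isTest_deriv.toL2 x ∂unitMeasure = 0 := by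
  rw [integral_congr_ae h.isTest_deriv.coeFn_toL2, setIntegral_Ioo_eq_intervalIntegral,
    intervalIntegral.integral_deriv_eq_sub, h.apply_eq_zero (x := 0) (by simp),
    h.apply_eq_zero (x := 1) (by simp), sub_zero]
  · exact fun y _ => (h.contDiff.differentiable (by simp)).differentiableAt
  · exact h.isTest_deriv.contDiff.continuous.intervalIntegrable _ _

theorem isWeakDeriv_iff {v v' : L2} :
    IsWeakDeriv v v' ↔ ∀ (η : ℝ → ℝ) (h : IsTest η),
      inner ℝ v h.isTest_deriv.toL2 = -inner ℝ v' h.toL2 := by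
  refine ⟨fun H η h => ?_, fun H η h1 h2 h3 => ?_⟩
  · rw [h.inner_toL2, h.isTest_deriv.inner_toL2, H η h.1 h.2 h.3]
  · have h : IsTest η := ⟨h1, h2, h3⟩
    rw [← h.inner_toL2, ← h.isTest_deriv.inner_toL2, H η h]

/-- The fundamental lemma of the calculus of variations on the open set `(0, 1)`. -/
theorem ae_eq_zero_of_integral_mul_test {f : ℝ → ℝ} (hf : Integrable f unitMeasure)
    (h : ∀ η, IsTest η → ∫ x in Ioo (0 : ℝ) 1, f x * η x = 0) : f =ᵐ[unitMeasure] 0 := by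
  have hloc : LocallyIntegrableOn f (Ioo (0 : ℝ) 1) volume :=
    IntegrableOn.locallyIntegrableOn hf
  have key := isOpen_Ioo.ae_eq_zero_of_integral_contDiff_smul_eq_zero hloc fun η h1 h2 h3 => by
    have hη : IsTest η := ⟨h1, h2, h3⟩
    rw [← h η hη]
    rw [← integral_indicator measurableSet_Ioo]
    refine integral_congr_ae (Eventually.of_forall fun x => ?_)
    by_cases hx : x ∈ Ioo (0 : ℝ) 1
    · simp [hx, mul_comm]
    · simp [hx, hη.apply_eq_zero hx]
  exact (ae_restrict_iff' measurableSet_Ioo).mpr key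

theorem eq_zero_of_inner_test {v : L2} (h : ∀ (η : ℝ → ℝ) (hη : IsTest η),
    inner ℝ v hη.toL2 = 0) : v = 0 := by
  refine Lp.ext ((ae_eq_zero_of_integral_mul_test (integrable_unit v) fun η hη => ?_).trans
    (Lp.coeFn_zero ℝ 2 unitMeasure).symm)
  rw [← hη.inner_toL2, h η hη]

theorem exists_isTest_integral_eq_one : ∃ ρ, IsTest ρ ∧ ∫ x in Ioo (0 : ℝ) 1, ρ x = 1 := by
  let b : ContDiffBump (1 / 2 : ℝ) := ⟨1 / 8, 1 / 4, by norm_num, by norm_num⟩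
  have hsub : Metric.closedBall (1 / 2 : ℝ) (1 / 4) ⊆ Ioo (0 : ℝ) 1 := by
    rw [Real.closedBall_eq_Icc]
    exact Icc_subset_Ioo (by norm_num) (by norm_num)
  have h : IsTest (b.normed volume) :=
    ⟨b.contDiff_normed, b.hasCompactSupport_normed, by rw [b.tsupport_normed_eq]; exact hsub⟩
  refine ⟨_, h, ?_⟩
  refine Eq.trans ?_ (b.integral_normed (μ := volume))
  rw [← integral_indicator measurableSet_Ioo]
  refine integral_congr_ae (Eventually.of_forall fun x => ?_)
  by_cases hx : x ∈ Ioo (0 : ℝ) 1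
  · simp [hx]
  · simp [hx, h.apply_eq_zero hx]

/-- A test function with vanishing integral is the derivative of a test function. -/
theorem IsTest.exists_deriv_eq {θ : ℝ → ℝ} (hθ : IsTest θ)
    (h0 : ∫ x in Ioo (0 : ℝ) 1, θ x = 0) : ∃ η, IsTest η ∧ deriv η = θ := by
  have hcont : Continuous θ := hθ.contDiff.continuous
  set η : ℝ → ℝ := fun x => ∫ y in (0 : ℝ)..x, θ y with hη
  have hderiv : ∀ x, HasDerivAt η (θ x) x := fun x =>
    intervalIntegral.integral_hasDerivAt_right (hcont.intervalIntegrable _ _)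
      (hcont.stronglyMeasurableAtFilter _ _) hcont.continuousAt
  have hd : deriv η = θ := funext fun x => (hderiv x).deriv
  have hcompact : IsCompact (tsupport θ) := hθ.hasCompactSupport
  obtain ⟨a, b, ha, hb, hab⟩ : ∃ a b : ℝ, 0 < a ∧ b < 1 ∧ tsupport θ ⊆ Icc a b := by
    rcases (tsupport θ).eq_empty_or_nonempty with he | hne
    -- For `θ = 0` the support has no infimum to use, and any interval inside `(0, 1)` serves.
    · exact ⟨1 / 2, 1 / 2, by norm_num, by norm_num, by simp [he]⟩
    · exact ⟨sInf (tsupport θ), sSup (tsupport θ),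
        (hθ.tsupport_subset (hcompact.sInf_mem hne)).1,
        (hθ.tsupport_subset (hcompact.sSup_mem hne)).2,
        fun x hx => ⟨csInf_le hcompact.bddBelow hx, le_csSup hcompact.bddAbove hx⟩⟩
  have hz : ∀ x, x ∉ Icc a b → θ x = 0 := fun x hx =>
    image_eq_zero_of_notMem_tsupport fun hx' => hx (hab hx')
  have hηz : ∀ x, x ∉ Icc a b → η x = 0 := by
    intro x hx
    rw [mem_Icc, not_and_or, not_le, not_le] at hx
    rcases hx with hx | hx
    · refine intervalIntegral.integral_zero_ae (Eventually.of_forall fun y hy => hz y fun hy' => ?_)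
      rcases le_total 0 x with h | h
      · rw [uIoc_of_le h] at hy; linarith [hy.2, hy'.1]
      · rw [uIoc_of_ge h] at hy; linarith [hy.2, hy'.1]
    -- To the right of `b` the remaining integral vanishes, so `η x` is the total integral of `θ`,
    -- which is zero.
    · have h2 : ∫ y in x..1, θ y = 0 := by
        refine intervalIntegral.integral_zero_ae
          (Eventually.of_forall fun y hy => ?_)
        rcases le_total x 1 with h | h
        · rw [uIoc_of_le h] at hy
          exact hz y fun hy' => by linarith [hy.1, hy'.2]
        · rw [uIoc_of_ge h] at hy
          exact hz y fun hy' => by linarith [hy.1, hy'.2]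
      rw [setIntegral_Ioo_eq_intervalIntegral, ← intervalIntegral.integral_add_adjacent_intervals
        (hcont.intervalIntegrable 0 x) (hcont.intervalIntegrable x 1), h2, add_zero] at h0
      exact h0
  have hts : tsupport η ⊆ Icc a b :=
    closure_minimal (fun x hx => by_contra fun hx' => hx (hηz x hx')) isClosed_Icc
  refine ⟨η, ⟨?_, ?_, hts.trans (Icc_subset_Ioo ha hb)⟩, hd⟩
  · rw [contDiff_infty_iff_deriv, hd]
    exact ⟨fun x => (hderiv x).differentiableAt, hθ.contDiff⟩
  · exact isCompact_Icc.of_isClosed_subset (isClosed_tsupport η) hts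

/-- The lemma of du Bois-Reymond. -/
theorem ae_eq_const_of_inner_deriv_test {v : L2} (h : ∀ (η : ℝ → ℝ) (hη : IsTest η),
    inner ℝ v hη.isTest_deriv.toL2 = 0) : ∃ c : ℝ, v =ᵐ[unitMeasure] fun _ => c := by
  obtain ⟨ρ, hρ, hρ1⟩ := exists_isTest_integral_eq_one
  set c := ∫ x in Ioo (0 : ℝ) 1, v x * ρ x with hc
  refine ⟨c, ?_⟩
  have key : (fun x => v x - c) =ᵐ[unitMeasure] 0 := by
    refine ae_eq_zero_of_integral_mul_test ((integrable_unit v).sub (integrable_const c))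
      fun θ hθ => ?_
    set m := ∫ x in Ioo (0 : ℝ) 1, θ x with hm
    -- Subtracting `m * ρ` makes the integral zero, so the difference is the derivative of a test
    -- function and is orthogonal to `v`.
    have hsub : IsTest fun x => θ x - m * ρ x := by
      refine ⟨hθ.contDiff.sub (contDiff_const.mul hρ.contDiff),
        hθ.hasCompactSupport.sub (hρ.hasCompactSupport.mul_left (f := fun _ => m)), ?_⟩
      refine (tsupport_sub θ fun x => m * ρ x).trans (union_subset hθ.tsupport_subset ?_)
      exact (tsupport_mul_subset_right (f := fun _ => m)).trans hρ.tsupport_subset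
    have h0 : ∫ x in Ioo (0 : ℝ) 1, θ x - m * ρ x = 0 := by
      rw [integral_sub hθ.integrable (hρ.integrable.const_mul m), integral_const_mul, hρ1, mul_one,
        sub_self]
    obtain ⟨η, hη, hηd⟩ := hsub.exists_deriv_eq h0
    have h1 := h η hη
    rw [hη.isTest_deriv.inner_toL2, hηd] at h1
    have i1 := integrable_mul_test v hθ.contDiff.continuous hθ.hasCompactSupport
    have i2 := integrable_mul_test v hρ.contDiff.continuous hρ.hasCompactSupport
    have e1 : ∀ x, v x * (θ x - m * ρ x) = v x * θ x - m * (v x * ρ x) := fun x => by ring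
    simp_rw [e1] at h1
    rw [integral_sub i1 (i2.const_mul m), integral_const_mul, ← hc] at h1
    simp_rw [sub_mul]
    rw [integral_sub i1 (hθ.integrable.const_mul c), integral_const_mul, ← hm]
    linarith
  filter_upwards [key] with x hx
  exact sub_eq_zero.mp hx

/-- An `L²` function with a weak derivative is a primitive of it, up to a constant. -/
theorem IsWeakDeriv.ae_eq_primitive {v v' : L2} (h : IsWeakDeriv v v') :
    ∃ c : ℝ, v =ᵐ[unitMeasure] fun x => primitive v' x + c := by
  obtain ⟨c, hc⟩ := ae_eq_const_of_inner_deriv_test (v := v - volterra v') fun η hη => by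
    have := inner_volterra_add v' hη.isTest_deriv.toL2
    rw [hη.volterra_deriv, hη.integral_deriv_toL2, mul_zero] at this
    rw [inner_sub_left, isWeakDeriv_iff.mp h η hη]
    linarith
  refine ⟨c, ?_⟩
  filter_upwards [hc, Lp.coeFn_sub v (volterra v'), coeFn_volterra v'] with x h1 h2 h3
  rw [h2, Pi.sub_apply, h3] at h1
  linarith

theorem IsWeakDeriv.eq_of_eq {v v₁ v₂ : L2} (h₁ : IsWeakDeriv v v₁) (h₂ : IsWeakDeriv v v₂) :
    v₁ = v₂ := by
  rw [← sub_eq_zero]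
  refine eq_zero_of_inner_test fun η hη => ?_
  have e1 := isWeakDeriv_iff.mp h₁ η hη
  have e2 := isWeakDeriv_iff.mp h₂ η hη
  rw [inner_sub_left]
  linarith

theorem isWeakDeriv_volterra (w : L2) : IsWeakDeriv (volterra w) w := by
  rw [isWeakDeriv_iff]
  intro η hη
  have := inner_volterra_add w hη.isTest_deriv.toL2
  rw [hη.volterra_deriv, hη.integral_deriv_toL2, mul_zero] at this
  linarith

theorem hasZeroTrace_volterra {w : L2} (h : ∫ x, w x ∂unitMeasure = 0) :
    HasZeroTrace (volterra w) :=
  ⟨primitive w, (continuous_primitive w).continuousOn, (coeFn_volterra w).symm,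
    primitive_zero_right w, (primitive_one w).trans h⟩

/-- The continuous representative equals `primitive v' + c` almost everywhere, hence everywhere on
`[0, 1]`. Its value at 0 gives `c = 0`, and its value at 1 is then the mean of `v'`. This identifies
H¹₀ with the mean-zero functions. -/
theorem HasZeroTrace.eq_volterra {v v' : L2} (h0 : HasZeroTrace v) (h : IsWeakDeriv v v') :
    v = volterra v' ∧ ∫ x, v' x ∂unitMeasure = 0 := by
  obtain ⟨c, hc⟩ := h.ae_eq_primitive
  obtain ⟨d, hd, hdv, d0, d1⟩ := h0
  have heq : EqOn d (fun x => primitive v' x + c) (Icc 0 1) := by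
    refine Measure.eqOn_Icc_of_ae_eq volume zero_ne_one ?_ hd
      ((continuous_primitive v').add continuous_const).continuousOn
    rw [restrict_Ioo_eq_restrict_Icc.symm]
    exact hdv.trans hc
  have hc0 : c = 0 := by
    have := heq (left_mem_Icc.mpr zero_le_one)
    simp only [d0, primitive_zero_right, zero_add] at this
    exact this.symm
  subst hc0
  refine ⟨Lp.ext ?_, ?_⟩
  · filter_upwards [hc, coeFn_volterra v'] with x h1 h2
    rw [h1, h2, add_zero]
  · have := heq (right_mem_Icc.mpr zero_le_one)
    simp only [d1, add_zero, primitive_one] at this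
    exact this.symm

/-- Weak derivatives are unique, so equality in L² already gives equality in H² ∩ H¹₀. -/
theorem toL2_injective : Function.Injective toL2 := by
  rintro ⟨v, hv⟩ ⟨w, hw⟩ h
  have h0 : v 0 = w 0 := h
  have h1 : v 1 = w 1 := hv.1.eq_of_eq (h0 ▸ hw.1)
  have h2 : v 2 = w 2 := hv.2.1.eq_of_eq (h1 ▸ hw.2.1)
  refine Subtype.ext (PiLp.ext fun i => ?_)
  fin_cases i
  exacts [h0, h1, h2]

/-- Integration by parts against an element of `H¹₀`. -/
theorem IsWeakDeriv.inner_eq_neg {v v' z : L2} (h : IsWeakDeriv v v')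
    (hz : ∫ x, z x ∂unitMeasure = 0) : inner ℝ v z = -inner ℝ v' (volterra z) := by
  obtain ⟨c, hc⟩ := h.ae_eq_primitive
  have h1 := inner_volterra_add v' z
  rw [hz, mul_zero] at h1
  -- `v - volterra v'` is constant and `z` has mean zero.
  have h2 : inner ℝ v z - inner ℝ (volterra v') z = 0 := by
    rw [← inner_sub_left, inner_eq_integral, ← mul_zero c, ← hz, ← integral_const_mul]
    refine integral_congr_ae ?_
    filter_upwards [hc, Lp.coeFn_sub v (volterra v'), coeFn_volterra v'] with x e1 e2 e3
    rw [e2, Pi.sub_apply, e1, e3]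
    ring
  linarith

/-! ### Spectral theory of the Sturm-Liouville operator -/

/-- Multiplication by a bounded function on `L²(0,1)`. -/
def mulOp (g : LInf) : L2 →L[ℝ] L2 :=
  LinearMap.mkContinuous
    { toFun := fun w => (g • w : L2)
      map_add' := Lp.add_smul g
      map_smul' := fun c w => (Lp.smul_comm c g w).symm } ‖g‖ (Lp.norm_smul_le g)

theorem coeFn_mulOp (g : LInf) (w : L2) : mulOp g w =ᵐ[unitMeasure] fun x => g x * w x :=
  Lp.coeFn_lpSMul g w

theorem inner_mulOp_left (g : LInf) (v w : L2) :
    inner ℝ (mulOp g v) w = ∫ x, g x * (v x * w x) ∂unitMeasure := by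
  rw [inner_eq_integral]
  refine integral_congr_ae ?_
  filter_upwards [coeFn_mulOp g v] with x hx
  rw [hx, mul_assoc]

theorem mulOp_symm (g : LInf) (v w : L2) :
    inner ℝ (mulOp g v) w = inner ℝ v (mulOp g w) := by
  rw [inner_mulOp_left, real_inner_comm, inner_mulOp_left]
  simp only [mul_comm (v _)]

theorem mulOp_nonneg {g : LInf} (hg : 0 ≤ g) (v : L2) : 0 ≤ inner ℝ (mulOp g v) v := by
  rw [inner_mulOp_left]
  refine integral_nonneg_of_ae ?_
  filter_upwards [(Lp.coeFn_nonneg g).mpr hg] with x hx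
  exact mul_nonneg hx (mul_self_nonneg _)

/-- The `L²` functions with vanishing integral. -/
def meanZero : Submodule ℝ L2 := (ℝ ∙ (Lp.const 2 unitMeasure (1 : ℝ)))ᗮ

instance : CompleteSpace meanZero := inferInstanceAs (CompleteSpace (_ᗮ : Submodule ℝ L2))

theorem mem_meanZero {w : L2} : w ∈ meanZero ↔ ∫ x, w x ∂unitMeasure = 0 := by
  rw [meanZero, Submodule.mem_orthogonal_singleton_iff_inner_right, inner_eq_integral]
  refine Eq.congr_left (integral_congr_ae ?_)
  filter_upwards [Lp.coeFn_const (p := 2) (μ := unitMeasure) (c := (1 : ℝ))] with x hx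
  rw [hx, Function.const_apply, one_mul]

/-- The solution operator of `-(v'' - g v) = h` in `H² ∩ H¹₀`. -/
theorem exists_resolvent {g : LInf} (hg : 0 ≤ g) :
    ∃ T : L2 →L[ℝ] L2, IsCompactOperator T ∧ (T : L2 →ₗ[ℝ] L2).IsSymmetric ∧
      (∀ h, 0 ≤ inner ℝ (T h) h) ∧
      (∀ h, ∃ v : domain, toL2 v = T h ∧ sturmLiouville g v = -h) ∧
      ∀ v : domain, T (sturmLiouville g v) = -toL2 v := by
  -- With v = `J w`, the form `⟪w, z⟫ + ⟪g J w, J z⟫` is the Dirichlet form ∫ v'ζ' + ∫ gvζ, where ζ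
  -- = `J z`.
  let J : meanZero →L[ℝ] L2 := volterra ∘L meanZero.subtypeL
  have hJ : ∀ w : meanZero, J w = volterra w := fun w => rfl
  have hJc : IsCompactOperator J := isCompactOperator_volterra.comp_clm meanZero.subtypeL
  obtain ⟨T, hTc, hTs, hT0, hT⟩ := exists_form_resolvent J hJc (mulOp g) (mulOp_symm g)
    (mulOp_nonneg hg)
  refine ⟨T, hTc, hTs, hT0, fun h => ?_, fun v => ?_⟩
  · obtain ⟨w, hw, hweak, -⟩ := hT h
    -- Testing with derivatives of test functions turns the variational equation into v'' = gv - h.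
    have hw' : IsWeakDeriv w (mulOp g (J w) - h) := by
      rw [isWeakDeriv_iff]
      intro η hη
      have := hweak ⟨hη.isTest_deriv.toL2, mem_meanZero.mpr hη.integral_deriv_toL2⟩
      rw [hJ ⟨hη.isTest_deriv.toL2, _⟩, hη.volterra_deriv, Submodule.coe_inner] at this
      rw [inner_sub_left]
      linarith
    refine ⟨⟨WithLp.toLp 2 ![volterra w, w, mulOp g (J w) - h], isWeakDeriv_volterra w, hw',
      hasZeroTrace_volterra (mem_meanZero.mp w.2)⟩, hw.symm, ?_⟩
    change mulOp g (J w) - h - mulOp g (J w) = -h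
    abel
  · obtain ⟨w, hw, -, huniq⟩ := hT (-sturmLiouville g v)
    obtain ⟨h1, h2, h3⟩ := v.2
    obtain ⟨e0, e1⟩ := h3.eq_volterra h1
    -- The derivative of `v` solves the variational problem with right side `-𝓛v`, so uniqueness
    -- identifies it with `w`.
    have := huniq ⟨_, mem_meanZero.mpr e1⟩ fun z => by
      have hz := h2.inner_eq_neg (mem_meanZero.mp z.2)
      rw [Submodule.coe_inner, hz, hJ, hJ, ← e0]
      change _ = inner ℝ (-(secondDeriv v - mulOp g (toL2 v))) _
      rw [inner_neg_left, inner_sub_left]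
      simp only [secondDeriv, toL2]
      ring
    rw [← this, hJ, ← e0, map_neg] at hw
    rw [← neg_eq_iff_eq_neg, hw]
    rfl

/-- The eigenfunctions of the Sturm-Liouville operator are complete in `L²(0,1)`. -/
theorem exists_eigenfunction_inner_ne_zero {g : LInf} (hg : 0 ≤ g) {h : L2} (hh : h ≠ 0) :
    ∃ lam : ℝ, ∃ e : domain, 0 < lam ∧ IsEigenvalue g lam ∧
      (∀ v, inner ℝ (sturmLiouville g v) (toL2 e) = -(lam * inner ℝ (toL2 v) (toL2 e))) ∧
      inner ℝ h (toL2 e) ≠ 0 := by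
  obtain ⟨T, hTc, hTs, hT0, hT, hT'⟩ := exists_resolvent hg
  -- By the spectral theorem some eigenvector of `T` is not orthogonal to `h`.
  have hbot := T.orthogonalComplement_iSup_eigenspaces_eq_bot hTc hTs
  have hmem : h ∉ (⨆ μ, Module.End.eigenspace (T : Module.End ℝ L2) μ)ᗮ := by
    rw [hbot, Submodule.mem_bot]; exact hh
  simp only [← Submodule.iInf_orthogonal, Submodule.mem_iInf, Submodule.mem_orthogonal,
    not_forall] at hmem
  obtain ⟨μ, u, hu, huh⟩ := hmem
  have hTu : T u = μ • u := Module.End.mem_eigenspace_iff.mp hu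
  have hu0 : u ≠ 0 := by
    rintro rfl
    exact huh (inner_zero_left _)
  obtain ⟨v, hv, hLv⟩ := hT u
  -- The kernel of `T` is trivial: `T u = 0` gives `v = 0`, hence `-u = 𝓛v = 0`.
  have hμ0 : μ ≠ 0 := by
    rintro rfl
    rw [hTu, zero_smul] at hv
    have hv0 : v = 0 := toL2_injective hv
    subst hv0
    have := hT' 0
    rw [hLv, map_neg, neg_inj] at this
    have h0 : sturmLiouville g 0 = 0 := by
      change (0 : L2) - mulOp g 0 = 0
      rw [map_zero, sub_zero]
    rw [hLv, neg_eq_zero] at h0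
    exact hu0 h0
  have hμ : 0 < μ := by
    have := hT0 u
    rw [hTu, real_inner_smul_left] at this
    have hpos : 0 < inner ℝ u u := real_inner_self_pos.mpr hu0
    exact lt_of_le_of_ne (nonneg_of_mul_nonneg_left this hpos) hμ0.symm
  rw [hTu] at hv
  refine ⟨μ⁻¹, v, inv_pos.mpr hμ, ⟨v, ?_, ?_⟩, fun v' => ?_, ?_⟩
  · rw [hv]
    exact smul_ne_zero hμ0 hu0
  · rw [hLv, hv, inv_smul_smul₀ hμ0]
  -- Symmetry of `T` takes the place of a double integration by parts.
  · have hs : inner ℝ (T (sturmLiouville g v')) u = inner ℝ (sturmLiouville g v') (T u) :=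
      hTs _ _
    rw [hv, ← hTu, ← hs, hT' v', hTu, real_inner_smul_right, inner_neg_left,
      inv_mul_cancel_left₀ hμ0]
  · rw [hv, real_inner_smul_right, real_inner_comm]
    exact mul_ne_zero hμ0 huh

/-! ### The Mittag-Leffler series -/

/-- Keep only the part `s > R` of the Gamma integral, where `s ^ x ≥ R ^ x`. As `R` is free, `Γ(αn +
1)` outgrows every geometric sequence. -/
theorem rpow_mul_exp_neg_le_Gamma {x R : ℝ} (hx : 0 ≤ x) (hR : 0 < R) :
    R ^ x * Real.exp (-R) ≤ Real.Gamma (x + 1) := by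
  have hint := Real.GammaIntegral_convergent (s := x + 1) (by linarith)
  rw [add_sub_cancel_right] at hint
  have hsub : Ioi R ⊆ Ioi (0 : ℝ) := Ioi_subset_Ioi hR.le
  rw [Real.Gamma_eq_integral (by linarith), add_sub_cancel_right]
  calc R ^ x * Real.exp (-R) = ∫ s in Ioi R, R ^ x * Real.exp (-s) := by
        rw [integral_const_mul, integral_exp_neg_Ioi]
    _ ≤ ∫ s in Ioi R, Real.exp (-s) * s ^ x := by
        refine setIntegral_mono_on ((integrableOn_exp_neg_Ioi R).const_mul _) (hint.mono_set hsub)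
          measurableSet_Ioi fun s hs => ?_
        rw [mul_comm]
        gcongr
        exact le_of_lt hs
    _ ≤ ∫ s in Ioi (0 : ℝ), Real.exp (-s) * s ^ x := by
        refine setIntegral_mono_set hint ?_ hsub.eventuallyLE
        filter_upwards [ae_restrict_mem measurableSet_Ioi] with s hs
        exact mul_nonneg (Real.exp_pos _).le (Real.rpow_nonneg (le_of_lt hs) _)

theorem summable_mittagLeffler {α : ℝ} (hα : 0 < α) (z : ℝ) :
    Summable fun n : ℕ => z ^ n / Real.Gamma (α * n + 1) := by
  -- Chosen so that `R ^ α = 2|z| + 1`, which leaves a geometric series of ratio below 1.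
  set R : ℝ := (2 * |z| + 1) ^ α⁻¹ with hRdef
  have hb : 0 < 2 * |z| + 1 := by positivity
  have hR : 0 < R := Real.rpow_pos_of_pos hb _
  have hRα : R ^ α = 2 * |z| + 1 := by
    rw [hRdef, ← Real.rpow_mul hb.le, inv_mul_cancel₀ hα.ne', Real.rpow_one]
  refine Summable.of_norm_bounded (g := fun n : ℕ => Real.exp R * (|z| / (2 * |z| + 1)) ^ n)
    (Summable.mul_left _ (summable_geometric_of_lt_one (by positivity) ?_)) fun n => ?_
  · rw [div_lt_one hb]
    linarith [abs_nonneg z]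
  · have h := rpow_mul_exp_neg_le_Gamma (x := α * n) (by positivity) hR
    rw [Real.rpow_mul_natCast hR.le, hRα] at h
    have hG : 0 < Real.Gamma (α * n + 1) := Real.Gamma_pos_of_pos (by positivity)
    rw [norm_div, norm_pow, Real.norm_eq_abs, Real.norm_of_nonneg hG.le, div_le_iff₀ hG, div_pow]
    calc |z| ^ n = Real.exp R * (|z| ^ n / (2 * |z| + 1) ^ n)
          * ((2 * |z| + 1) ^ n * Real.exp (-R)) := by
          rw [Real.exp_neg]
          field_simp
      _ ≤ _ := by gcongr

/-! ### Beta integrals and Riemann-Liouville kernels -/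

theorem integral_rpow_mul_rpow {a b t : ℝ} (ha : 0 < a) (hb : 0 < b) (ht : 0 < t) :
    ∫ s in (0 : ℝ)..t, (t - s) ^ (a - 1) * s ^ (b - 1)
      = Real.Gamma a * Real.Gamma b / Real.Gamma (a + b) * t ^ (a + b - 1) := by
  have h := Complex.betaIntegral_scaled (b : ℂ) (a : ℂ) ht
  rw [Complex.betaIntegral_eq_Gamma_mul_div _ _ (by simpa) (by simpa)] at h
  have h1 : ∫ s in (0 : ℝ)..t, (s : ℂ) ^ ((b : ℂ) - 1) * ((t : ℂ) - s) ^ ((a : ℂ) - 1)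
      = ((∫ s in (0 : ℝ)..t, (t - s) ^ (a - 1) * s ^ (b - 1) : ℝ) : ℂ) := by
    rw [← intervalIntegral.integral_ofReal]
    refine intervalIntegral.integral_congr fun s hs => ?_
    rw [uIcc_of_le ht.le] at hs
    rw [Complex.ofReal_mul, Complex.ofReal_cpow (by linarith [hs.2]), Complex.ofReal_cpow hs.1]
    push_cast
    ring
  rw [h1, Complex.Gamma_ofReal, Complex.Gamma_ofReal, ← Complex.ofReal_add, Complex.Gamma_ofReal,
    ← Complex.ofReal_one, ← Complex.ofReal_sub, ← Complex.ofReal_cpow ht.le] at h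
  have h2 : ∫ s in (0 : ℝ)..t, (t - s) ^ (a - 1) * s ^ (b - 1)
    = t ^ (b + a - 1) * (Real.Gamma b * Real.Gamma a / Real.Gamma (b + a)) := by exact_mod_cast h
  rw [h2, add_comm b a]
  ring

theorem intervalIntegrable_rpow_mul_rpow {a b t : ℝ} (ha : 0 < a) (hb : 0 < b) (ht : 0 < t) :
    IntervalIntegrable (fun s => (t - s) ^ (a - 1) * s ^ (b - 1)) volume 0 t := by
  -- A non-integrable function has integral 0 by convention, so the positive Beta value proves
  -- integrability.
  refine intervalIntegral.intervalIntegrable_of_integral_ne_zero ?_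
  rw [integral_rpow_mul_rpow ha hb ht]
  have := Real.Gamma_pos_of_pos ha
  have := Real.Gamma_pos_of_pos hb
  have := Real.Gamma_pos_of_pos (add_pos ha hb)
  positivity

/-- A translated Beta integral; the exponents `α` and `1 - α` add up to 1, so the value does not
depend on `r` and `t`. -/
theorem integral_abel_kernel {α r t : ℝ} (h0 : 0 < α) (h1 : α < 1) (hrt : r < t) :
    ∫ s in r..t, (t - s) ^ (α - 1) * (s - r) ^ (-α) = Real.Gamma α * Real.Gamma (1 - α) := by
  have h := integral_rpow_mul_rpow h0 (sub_pos.mpr h1) (sub_pos.mpr hrt)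
  rw [add_sub_cancel, sub_self, Real.Gamma_one, div_one, Real.rpow_zero, mul_one] at h
  rw [← h, show (0 : ℝ) = r - r by ring, ← intervalIntegral.integral_comp_sub_right
    (fun s => (t - r - s) ^ (α - 1) * s ^ (1 - α - 1))]
  refine intervalIntegral.integral_congr fun s _ => ?_
  rw [show t - r - (s - r) = t - s by ring, show 1 - α - 1 = -α by ring]

theorem intervalIntegrable_abel_kernel {α r t : ℝ} (h0 : 0 < α) (h1 : α < 1) (hrt : r < t) :
    IntervalIntegrable (fun s => (t - s) ^ (α - 1) * (s - r) ^ (-α)) volume r t := by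
  refine intervalIntegral.intervalIntegrable_of_integral_ne_zero ?_
  rw [integral_abel_kernel h0 h1 hrt]
  exact (mul_pos (Real.Gamma_pos_of_pos h0) (Real.Gamma_pos_of_pos (sub_pos.mpr h1))).ne'

theorem intervalIntegrable_sub_rpow {c : ℝ} (hc : -1 < c) (a b t : ℝ) :
    IntervalIntegrable (fun s => (t - s) ^ c) volume a b := by
  have := (intervalIntegral.intervalIntegrable_rpow' (a := t - a) (b := t - b) hc).comp_sub_left t
  simpa using this

/-- Abel's inversion of the Riemann-Liouville integral. -/
theorem abel_inversion {α a t : ℝ} (h0 : 0 < α) (h1 : α < 1) (hat : a < t) {h : ℝ → ℝ}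
    (hh : ContinuousOn h (Icc a t)) :
    IntervalIntegrable (fun s => (t - s) ^ (α - 1) * ∫ r in a..s, (s - r) ^ (-α) * h r)
        volume a t ∧
      ∫ s in a..t, (t - s) ^ (α - 1) * ∫ r in a..s, (s - r) ^ (-α) * h r
        = Real.Gamma α * Real.Gamma (1 - α) * ∫ r in a..t, h r := by
  -- The kernels are cut off to integrable functions on ℝ, so the double integrand is a bounded
  -- factor times a convolution integrand and Fubini applies.
  set K₁ : ℝ → ℝ := (Ioo a t).indicator fun s => (t - s) ^ (α - 1) with hK₁
  set K₂ : ℝ → ℝ := (Ioo (a - t) 0).indicator fun x => (0 - x) ^ (-α) with hK₂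
  set H : ℝ → ℝ := (Icc a t).indicator h with hH
  have iK₁ : Integrable K₁ := by
    rw [hK₁, integrable_indicator_iff measurableSet_Ioo,
      ← intervalIntegrable_iff_integrableOn_Ioo_of_le hat.le]
    exact intervalIntegrable_sub_rpow (by linarith) _ _ _
  have iK₂ : Integrable K₂ := by
    rw [hK₂, integrable_indicator_iff measurableSet_Ioo,
      ← intervalIntegrable_iff_integrableOn_Ioo_of_le (by linarith)]
    exact intervalIntegrable_sub_rpow (by linarith) _ _ _
  have mH : AEStronglyMeasurable H volume := by
    rw [hH, aestronglyMeasurable_indicator_iff measurableSet_Icc]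
    exact hh.aestronglyMeasurable measurableSet_Icc
  obtain ⟨C, hC⟩ := isCompact_Icc.exists_bound_of_continuousOn hh
  have bH : ∀ r, ‖H r‖ ≤ |C| := by
    intro r
    by_cases hr : r ∈ Icc a t
    · rw [hH, indicator_of_mem hr]
      exact (hC r hr).trans (le_abs_self C)
    · rw [hH, indicator_of_notMem hr, norm_zero]
      exact abs_nonneg C
  have iG : Integrable (Function.uncurry fun s r => H r * (K₁ s * K₂ (r - s)))
      (volume.prod volume) := by
    have h2 : Integrable (fun p : ℝ × ℝ => K₁ p.1 * K₂ (p.2 - p.1)) (volume.prod volume) :=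
      (iK₁.convolution_integrand (ContinuousLinearMap.mul ℝ ℝ) iK₂).swap
    exact h2.bdd_mul mH.comp_snd (Eventually.of_forall fun p => bH p.2)
  have inner_r : ∀ s ∈ Ioo a t, ∫ r, H r * (K₁ s * K₂ (r - s))
      = (t - s) ^ (α - 1) * ∫ r in a..s, (s - r) ^ (-α) * h r := by
    intro s hs
    rw [intervalIntegral.integral_of_le hs.1.le, integral_Ioc_eq_integral_Ioo,
      ← integral_indicator measurableSet_Ioo, ← integral_const_mul]
    refine integral_congr_ae ?_
    filter_upwards [Measure.ae_ne volume a] with r hra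
    by_cases hr : r ∈ Ioo a s
    · have e1 : r ∈ Icc a t := ⟨hr.1.le, (hr.2.trans hs.2).le⟩
      have e2 : r - s ∈ Ioo (a - t) 0 := ⟨by linarith [hr.1, hs.2], by linarith [hr.2]⟩
      simp only [hH, hK₁, hK₂, indicator_of_mem hr, indicator_of_mem e1, indicator_of_mem hs,
        indicator_of_mem e2, zero_sub, neg_sub]
      ring
    · rw [indicator_of_notMem hr, mul_zero]
      by_cases e1 : r ∈ Icc a t
      · have e2 : r - s ∉ Ioo (a - t) 0 := fun e2 =>
          hr ⟨lt_of_le_of_ne e1.1 (Ne.symm hra), by linarith [e2.2]⟩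
        simp only [hK₂, indicator_of_notMem e2, mul_zero]
      · simp only [hH, indicator_of_notMem e1, zero_mul]
  have inner_s : ∀ r, r ∈ Ioo a t → ∫ s, H r * (K₁ s * K₂ (r - s))
      = Real.Gamma α * Real.Gamma (1 - α) * h r := by
    intro r hr
    rw [integral_const_mul, hH, indicator_of_mem (Ioo_subset_Icc_self hr), mul_comm]
    congr 1
    rw [← integral_abel_kernel h0 h1 hr.2, intervalIntegral.integral_of_le hr.2.le,
      integral_Ioc_eq_integral_Ioo, ← integral_indicator measurableSet_Ioo]
    refine integral_congr_ae (Eventually.of_forall fun s => ?_)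
    by_cases hs : s ∈ Ioo r t
    · have e1 : s ∈ Ioo a t := ⟨hr.1.trans hs.1, hs.2⟩
      have e2 : r - s ∈ Ioo (a - t) 0 := ⟨by linarith [hr.1, hs.2], by linarith [hs.1]⟩
      simp only [hK₁, hK₂, indicator_of_mem hs, indicator_of_mem e1, indicator_of_mem e2,
        zero_sub, neg_sub]
    · simp only [indicator_of_notMem hs]
      by_cases e1 : s ∈ Ioo a t
      · have e2 : r - s ∉ Ioo (a - t) 0 := fun e2 => hs ⟨by linarith [e2.2], e1.2⟩
        simp only [hK₂, indicator_of_notMem e2, mul_zero]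
      · simp only [hK₁, indicator_of_notMem e1, zero_mul]
  have int_s : (fun s => ∫ r, H r * (K₁ s * K₂ (r - s))) = (Ioo a t).indicator fun s =>
      (t - s) ^ (α - 1) * ∫ r in a..s, (s - r) ^ (-α) * h r := by
    funext s
    by_cases hs : s ∈ Ioo a t
    · rw [indicator_of_mem hs, inner_r s hs]
    · rw [indicator_of_notMem hs]
      simp only [hK₁, indicator_of_notMem hs, zero_mul, mul_zero, integral_zero]
  have int_r : (fun r => ∫ s, H r * (K₁ s * K₂ (r - s))) =ᵐ[volume] (Ioo a t).indicator fun r =>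
      Real.Gamma α * Real.Gamma (1 - α) * h r := by
    filter_upwards [Measure.ae_ne volume a, Measure.ae_ne volume t] with r hra hrt
    by_cases hr : r ∈ Ioo a t
    · rw [indicator_of_mem hr, inner_s r hr]
    · have e : r ∉ Icc a t := fun e =>
        hr ⟨lt_of_le_of_ne e.1 (Ne.symm hra), lt_of_le_of_ne e.2 hrt⟩
      rw [indicator_of_notMem hr]
      simp only [hH, indicator_of_notMem e, zero_mul, integral_zero]
  constructor
  · have := iG.integral_prod_left
    simp only [Function.uncurry_apply_pair] at this
    rw [int_s, integrable_indicator_iff measurableSet_Ioo] at this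
    rwa [intervalIntegrable_iff_integrableOn_Ioo_of_le hat.le]
  · have := integral_integral_swap iG
    rw [int_s, integral_congr_ae int_r, integral_indicator measurableSet_Ioo,
      integral_indicator measurableSet_Ioo, integral_const_mul] at this
    rw [intervalIntegral.integral_of_le hat.le, intervalIntegral.integral_of_le hat.le,
      integral_Ioc_eq_integral_Ioo, integral_Ioc_eq_integral_Ioo, this]

/-! ### Inversion of the Caputo derivative -/

/-- Integration by parts moves the derivative onto the kernel, which increases in `r`. With `k r =
(s - r) ^ (-α)` the three terms are at most `m * k ε`, `m * k δ` and `m * (k ε - k δ)`. The bound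
involves neither `v'` nor `δ`, so it survives `δ → 0`. -/
theorem abs_integral_singular_le {α m v₀ δ ε s : ℝ} {v v' : ℝ → ℝ} (h0 : 0 < α) (hδε : δ ≤ ε)
    (hεs : ε < s) (hv : ∀ r ∈ Icc δ ε, HasDerivWithinAt v (v' r) (Icc δ ε) r)
    (hv' : ContinuousOn v' (Icc δ ε)) (hm : ∀ r ∈ Icc δ ε, |v r - v₀| ≤ m) :
    |∫ r in δ..ε, (s - r) ^ (-α) * v' r| ≤ 2 * m * (s - ε) ^ (-α) := by
  set k : ℝ → ℝ := fun r => (s - r) ^ (-α) with hk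
  set k' : ℝ → ℝ := fun r => α * (s - r) ^ (-α - 1) with hk'
  have hpos : ∀ r ∈ Icc δ ε, 0 < s - r := fun r hr => by linarith [hr.2]
  have hkd : ∀ r ∈ Icc δ ε, HasDerivAt k (k' r) r := by
    intro r hr
    have := ((hasDerivAt_id r).const_sub s).rpow_const (p := -α) (Or.inl (hpos r hr).ne')
    convert! this using 1
    simp [hk']
  have hk'c : ContinuousOn k' (Icc δ ε) := by
    refine continuousOn_const.mul (ContinuousOn.rpow_const (by fun_prop) fun r hr => ?_)
    exact Or.inl (hpos r hr).ne'
  have hkc : ContinuousOn k (Icc δ ε) := fun r hr => (hkd r hr).continuousAt.continuousWithinAt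
  have hvc : ContinuousOn v (Icc δ ε) := fun r hr => (hv r hr).continuousWithinAt
  have hk'nn : ∀ r ∈ Icc δ ε, 0 ≤ k' r := fun r hr =>
    mul_nonneg h0.le (Real.rpow_nonneg (hpos r hr).le _)
  have hkε : 0 ≤ k ε := Real.rpow_nonneg (by linarith) _
  have hkδ : 0 ≤ k δ := Real.rpow_nonneg (by linarith) _
  have huIcc : uIcc δ ε = Icc δ ε := uIcc_of_le hδε
  have parts := intervalIntegral.integral_mul_deriv_eq_deriv_mul_of_hasDerivAt
    (u := k) (u' := k') (v := fun r => v r - v₀) (v' := v') (a := δ) (b := ε)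
    (by rwa [huIcc]) (by rw [huIcc]; exact hvc.sub continuousOn_const)
    (fun r hr => by
      rw [min_eq_left hδε, max_eq_right hδε] at hr
      exact hkd r (Ioo_subset_Icc_self hr))
    (fun r hr => by
      rw [min_eq_left hδε, max_eq_right hδε] at hr
      exact ((hv r (Ioo_subset_Icc_self hr)).hasDerivAt (Icc_mem_nhds hr.1 hr.2)).sub_const v₀)
    (hk'c.intervalIntegrable_of_Icc hδε) (hv'.intervalIntegrable_of_Icc hδε)
  have hk'int : ∫ r in δ..ε, k' r = k ε - k δ :=
    intervalIntegral.integral_eq_sub_of_hasDerivAt (fun r hr => hkd r (huIcc ▸ hr))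
      (hk'c.intervalIntegrable_of_Icc hδε)
  have hrem : |∫ r in δ..ε, k' r * (v r - v₀)| ≤ m * (k ε - k δ) := by
    rw [← hk'int, ← intervalIntegral.integral_const_mul, ← Real.norm_eq_abs]
    refine intervalIntegral.norm_integral_le_of_norm_le hδε
      (Eventually.of_forall fun r hr => ?_)
      ((hk'c.intervalIntegrable_of_Icc hδε).const_mul m)
    have hr' := Ioc_subset_Icc_self hr
    rw [norm_mul, Real.norm_of_nonneg (hk'nn r hr'), mul_comm]
    exact mul_le_mul_of_nonneg_right (hm r hr') (hk'nn r hr')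
  have b1 := mul_le_mul_of_nonneg_left (hm ε (right_mem_Icc.mpr hδε)) hkε
  have b2 := mul_le_mul_of_nonneg_left (hm δ (left_mem_Icc.mpr hδε)) hkδ
  rw [parts]
  have a1 : |k ε * (v ε - v₀)| = k ε * |v ε - v₀| := by rw [abs_mul, abs_of_nonneg hkε]
  have a2 : |k δ * (v δ - v₀)| = k δ * |v δ - v₀| := by rw [abs_mul, abs_of_nonneg hkδ]
  have t1 := abs_sub (k ε * (v ε - v₀) - k δ * (v δ - v₀)) (∫ r in δ..ε, k' r * (v r - v₀))
  have t2 := abs_sub (k ε * (v ε - v₀)) (k δ * (v δ - v₀))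
  change _ ≤ 2 * m * k ε
  linarith

/-- A function is recovered from its Caputo derivative by the Riemann-Liouville integral. -/
theorem sub_eq_of_hasCaputoDeriv {α q : ℝ} (h0 : 0 < α) (h1 : α ≤ 1) {v v' w : ℝ → ℝ}
    (hvc : ContinuousOn v (Icc 0 q))
    (hv : ∀ t ∈ Ioc 0 q, HasDerivWithinAt v (v' t) (Ioc 0 q) t)
    (hv' : ContinuousOn v' (Ioc 0 q)) (hw : ContinuousOn w (Icc 0 q))
    (hcap : ∀ t ∈ Ioc 0 q, HasCaputoDeriv α v' t (w t)) {t : ℝ} (ht : t ∈ Ioc 0 q) :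
    v t - v 0 = (Real.Gamma α)⁻¹ * ∫ s in (0 : ℝ)..t, (t - s) ^ (α - 1) * w s := by
  have hwt : ContinuousOn w (Icc 0 t) := hw.mono (Icc_subset_Icc_right ht.2)
  rcases h1.eq_or_lt with rfl | h1
  · simp only [sub_self, Real.rpow_zero, one_mul, Real.Gamma_one, inv_one]
    symm
    refine intervalIntegral.integral_eq_sub_of_hasDeriv_right_of_le ht.1.le
      (hvc.mono (Icc_subset_Icc_right ht.2)) (fun x hx => ?_)
      (hwt.intervalIntegrable_of_Icc ht.1.le)
    have hx' : x ∈ Ioc 0 q := ⟨hx.1, hx.2.le.trans ht.2⟩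
    rw [(hcap x hx').1 rfl]
    exact ((hv x hx').hasDerivAt
      (Ioc_mem_nhds hx.1 (hx.2.trans_le ht.2))).hasDerivWithinAt
  have hG : 0 < Real.Gamma α := Real.Gamma_pos_of_pos h0
  have hG' : 0 < Real.Gamma (1 - α) := Real.Gamma_pos_of_pos (sub_pos.mpr h1)
  have hkw : IntervalIntegrable (fun s => (t - s) ^ (α - 1) * w s) volume 0 t :=
    (intervalIntegrable_sub_rpow (by linarith) _ _ _).mul_continuousOn
      (by rwa [uIcc_of_le ht.1.le])
  -- The Caputo integral over `(ε, s)` is close to the full one.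
  have hclose : ∀ m ε s : ℝ, 0 < ε → ε < s → s ≤ t → (∀ r ∈ Icc 0 ε, |v r - v 0| ≤ m) →
      |Real.Gamma (1 - α) * w s - ∫ r in ε..s, (s - r) ^ (-α) * v' r|
        ≤ 2 * m * (s - ε) ^ (-α) := by
    intro m ε s hε hεs hst hm
    have hs : s ∈ Ioc 0 q := ⟨hε.trans hεs, hst.trans ht.2⟩
    have hlim := ((hcap s hs).2 h1).const_mul (Real.Gamma (1 - α))
    have hlim' := (hlim.sub_const (∫ r in ε..s, (s - r) ^ (-α) * v' r)).abs
    refine le_of_tendsto hlim' ?_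
    filter_upwards [Ioc_mem_nhdsGT hε] with δ hδ
    have hsub : Icc δ s ⊆ Ioc 0 q := fun r hr => ⟨hδ.1.trans_le hr.1, hr.2.trans hs.2⟩
    have hint : ∀ a b, δ ≤ a → a ≤ b → b ≤ s →
        IntervalIntegrable (fun r => (s - r) ^ (-α) * v' r) volume a b := by
      intro a b ha hab hb
      refine (intervalIntegrable_sub_rpow (by linarith) _ _ _).mul_continuousOn ?_
      rw [uIcc_of_le hab]
      exact hv'.mono ((Icc_subset_Icc ha hb).trans hsub)
    have hsplit := intervalIntegral.integral_add_adjacent_intervals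
      (hint δ ε le_rfl hδ.2 hεs.le) (hint ε s hδ.2 hεs.le le_rfl)
    simp only [smul_eq_mul]
    rw [mul_inv_cancel_left₀ hG'.ne', ← hsplit, add_sub_cancel_right]
    have hsub' : Icc δ ε ⊆ Ioc 0 q := (Icc_subset_Icc_right hεs.le).trans hsub
    exact abs_integral_singular_le h0 hδ.2 hεs
      (fun r hr => (hv r (hsub' hr)).mono hsub') (hv'.mono hsub')
      (fun r hr => hm r ⟨hδ.1.le.trans hr.1, hr.2⟩)
  -- Hence the identity holds up to a small error with `ε` in place of `0`.
  have herr : ∀ m ε : ℝ, 0 < ε → ε < t → (∀ r ∈ Icc 0 ε, |v r - v 0| ≤ m) →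
      |Real.Gamma (1 - α) * (∫ s in ε..t, (t - s) ^ (α - 1) * w s)
        - Real.Gamma α * Real.Gamma (1 - α) * (v t - v ε)|
        ≤ 2 * m * (Real.Gamma α * Real.Gamma (1 - α)) := by
    intro m ε hε hεt hm
    have hsub : Icc ε t ⊆ Ioc 0 q := fun r hr => ⟨hε.trans_le hr.1, hr.2.trans ht.2⟩
    obtain ⟨hi, he⟩ := abel_inversion h0 h1 hεt (hv'.mono hsub)
    have hftc : ∫ r in ε..t, v' r = v t - v ε := by
      refine intervalIntegral.integral_eq_sub_of_hasDerivAt_of_le hεt.le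
        (hvc.mono (hsub.trans Ioc_subset_Icc_self)) (fun x hx => ?_)
        ((hv'.mono hsub).intervalIntegrable_of_Icc hεt.le)
      exact (hv x (hsub (Ioo_subset_Icc_self hx))).hasDerivAt
        (Ioc_mem_nhds (hε.trans hx.1) (hx.2.trans_le ht.2))
    have hkw' : IntervalIntegrable (fun s => Real.Gamma (1 - α) * ((t - s) ^ (α - 1) * w s))
        volume ε t :=
      (hkw.mono_set (by
        rw [uIcc_of_le hεt.le, uIcc_of_le ht.1.le]
        exact Icc_subset_Icc_left hε.le)).const_mul _
    -- Abel's inversion writes the increment of `v` with the truncated integrals. The pointwise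
    -- error then integrates against the Abel kernel, whose mass is independent of `ε`.
    rw [← hftc, ← he, ← intervalIntegral.integral_const_mul, ← intervalIntegral.integral_sub hkw' hi,
      ← integral_abel_kernel h0 h1 hεt, ← intervalIntegral.integral_const_mul, ← Real.norm_eq_abs]
    refine intervalIntegral.norm_integral_le_of_norm_le hεt.le
      (Eventually.of_forall fun s hs => ?_)
      ((intervalIntegrable_abel_kernel h0 h1 hεt).const_mul _)
    have hk : 0 ≤ (t - s) ^ (α - 1) := Real.rpow_nonneg (by linarith [hs.2]) _
    rw [show Real.Gamma (1 - α) * ((t - s) ^ (α - 1) * w s)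
        - (t - s) ^ (α - 1) * (∫ r in ε..s, (s - r) ^ (-α) * v' r)
        = (t - s) ^ (α - 1) * (Real.Gamma (1 - α) * w s
          - ∫ r in ε..s, (s - r) ^ (-α) * v' r) by ring, norm_mul, Real.norm_of_nonneg hk,
      Real.norm_eq_abs]
    refine (mul_le_mul_of_nonneg_left (hclose m ε s hε hs.1 hs.2 hm) hk).trans_eq ?_
    ring
  have hv0 : Tendsto v (𝓝[>] 0) (𝓝 (v 0)) :=
    ((hvc 0 ⟨le_rfl, ht.1.le.trans ht.2⟩).mono_of_mem_nhdsWithin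
      (mem_of_superset (Ioc_mem_nhdsGT (ht.1.trans_le ht.2)) Ioc_subset_Icc_self)).tendsto
  have hI0 : Tendsto (fun ε => ∫ s in ε..t, (t - s) ^ (α - 1) * w s) (𝓝[>] 0)
      (𝓝 (∫ s in (0 : ℝ)..t, (t - s) ^ (α - 1) * w s)) := by
    have hc := intervalIntegral.continuousOn_primitive_interval_left
      (f := fun s => (t - s) ^ (α - 1) * w s) (μ := volume) (a := 0) (b := t)
      (by
        rw [uIcc_of_le ht.1.le]
        exact (intervalIntegrable_iff_integrableOn_Icc_of_le ht.1.le).mp hkw)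
    refine ((hc 0 left_mem_uIcc).mono_of_mem_nhdsWithin ?_).tendsto
    rw [uIcc_of_le ht.1.le]
    exact mem_of_superset (Ioc_mem_nhdsGT ht.1) Ioc_subset_Icc_self
  -- Continuity of `v` at 0 makes the oscillation `m` as small as desired for small `ε`.
  have hfin : ∀ m > 0, |Real.Gamma (1 - α) * (∫ s in (0 : ℝ)..t, (t - s) ^ (α - 1) * w s)
        - Real.Gamma α * Real.Gamma (1 - α) * (v t - v 0)|
        ≤ 2 * m * (Real.Gamma α * Real.Gamma (1 - α)) := by
    intro m hm
    refine le_of_tendsto ((hI0.const_mul _).sub ((hv0.const_sub (v t)).const_mul _)).abs ?_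
    have hc0 := Metric.continuousWithinAt_iff.mp (hvc 0 ⟨le_rfl, ht.1.le.trans ht.2⟩) m hm
    obtain ⟨d, hd, hdv⟩ := hc0
    filter_upwards [Ioo_mem_nhdsGT hd, Ioo_mem_nhdsGT ht.1] with ε h2 h3
    refine herr m ε h2.1 h3.2 fun r hr => ?_
    have := hdv (x := r) ⟨hr.1, hr.2.trans (h3.2.le.trans ht.2)⟩ (by
      rw [Real.dist_eq, sub_zero, abs_of_nonneg hr.1]
      exact hr.2.trans_lt h2.2)
    rw [Real.dist_eq] at this
    exact this.le
  have hzero : Real.Gamma (1 - α) * (∫ s in (0 : ℝ)..t, (t - s) ^ (α - 1) * w s)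
        - Real.Gamma α * Real.Gamma (1 - α) * (v t - v 0) = 0 := by
    rw [← abs_nonpos_iff]
    refine le_of_forall_pos_le_add fun e he => ?_
    have hGG := mul_pos hG hG'
    refine (hfin (e / (2 * (Real.Gamma α * Real.Gamma (1 - α)))) (by positivity)).trans_eq ?_
    field_simp
    ring
  rw [inv_mul_eq_div, eq_div_iff hG.ne']
  refine mul_left_cancel₀ hG'.ne' ?_
  linarith

/-- The fractional relaxation equation is solved by the Mittag-Leffler function. -/
theorem eq_mittagLeffler_of_integral_eq {α q lam : ℝ} (h0 : 0 < α) (hlam : 0 < lam) {y : ℝ → ℝ}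
    (hy : ContinuousOn y (Icc 0 q))
    (heq : ∀ t ∈ Ioc 0 q, y t = y 0
      - lam * ((Real.Gamma α)⁻¹ * ∫ s in (0 : ℝ)..t, (t - s) ^ (α - 1) * y s))
    {t : ℝ} (ht : t ∈ Icc 0 q) : y t = y 0 * mittagLeffler α 1 (-lam * t ^ α) := by
  have hG : 0 < Real.Gamma α := Real.Gamma_pos_of_pos h0
  have hGn : ∀ n : ℕ, 0 < Real.Gamma (α * n + 1) := fun n => Real.Gamma_pos_of_pos (by positivity)
  rcases ht.1.eq_or_lt with rfl | ht0
  · rw [mittagLeffler, Real.zero_rpow h0.ne', mul_zero, tsum_eq_single 0]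
    · simp
    · intro n hn
      simp [hn]
  obtain ⟨M, hM⟩ := isCompact_Icc.exists_bound_of_continuousOn hy
  -- Partial sums of the candidate series, which are also the Picard iterates of the integral
  -- equation started from 0.
  set S : ℕ → ℝ → ℝ := fun N t =>
    ∑ n ∈ Finset.range N, y 0 * (-lam) ^ n / Real.Gamma (α * n + 1) * t ^ (α * n) with hS
  have hJ : ∀ (n : ℕ) {t : ℝ}, 0 < t →
      (Real.Gamma α)⁻¹ * ∫ s in (0 : ℝ)..t, (t - s) ^ (α - 1) * s ^ (α * n)
        = Real.Gamma (α * n + 1) / Real.Gamma (α * (n + 1 : ℕ) + 1) * t ^ (α * (n + 1 : ℕ)) := by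
    intro n t ht
    have := integral_rpow_mul_rpow h0 (b := α * n + 1) (by positivity) ht
    rw [add_sub_cancel_right, show α + (α * n + 1) = α * (n + 1 : ℕ) + 1 by push_cast; ring,
      add_sub_cancel_right] at this
    rw [this]
    field_simp
  have iJ : ∀ (n : ℕ) {t : ℝ}, 0 < t →
      IntervalIntegrable (fun s => (t - s) ^ (α - 1) * s ^ (α * n)) volume 0 t := by
    intro n t ht
    have := intervalIntegrable_rpow_mul_rpow h0 (b := α * n + 1) (by positivity) ht
    rwa [add_sub_cancel_right] at this
  -- Each Picard step integrates the previous error bound, so the error is dominated by `M` times a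
  -- term of the convergent series at `lam * t ^ α`.
  have hbound : ∀ N : ℕ, ∀ t ∈ Ioc 0 q,
      |y t - S N t| ≤ M * lam ^ N / Real.Gamma (α * N + 1) * t ^ (α * N) := by
    intro N
    induction N with
    | zero =>
      intro t ht
      simpa [hS] using hM t (Ioc_subset_Icc_self ht)
    | succ N ih =>
      intro t ht
      have iy : IntervalIntegrable (fun s => (t - s) ^ (α - 1) * y s) volume 0 t :=
        (intervalIntegrable_sub_rpow (by linarith) _ _ _).mul_continuousOn
          (by rw [uIcc_of_le ht.1.le]; exact hy.mono (Icc_subset_Icc_right ht.2))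
      have eS : ∀ s, (t - s) ^ (α - 1) * S N s = ∑ n ∈ Finset.range N,
          y 0 * (-lam) ^ n / Real.Gamma (α * n + 1) * ((t - s) ^ (α - 1) * s ^ (α * n)) := by
        intro s
        rw [hS, Finset.mul_sum]
        exact Finset.sum_congr rfl fun n _ => by ring
      have iS : IntervalIntegrable (fun s => (t - s) ^ (α - 1) * S N s) volume 0 t := by
        simp_rw [eS]
        have := IntervalIntegrable.sum (Finset.range N) fun n _ => (iJ n ht.1).const_mul
          (y 0 * (-lam) ^ n / Real.Gamma (α * n + 1))
        convert! this using 1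
        funext s
        rw [Finset.sum_apply]
      have hSsucc : S (N + 1) t = y 0
          - lam * ((Real.Gamma α)⁻¹ * ∫ s in (0 : ℝ)..t, (t - s) ^ (α - 1) * S N s) := by
        simp_rw [eS]
        rw [intervalIntegral.integral_finsetSum fun n _ => (iJ n ht.1).const_mul _, Finset.mul_sum,
          Finset.mul_sum, hS]
        simp only
        rw [Finset.sum_range_succ', sub_eq_add_neg, add_comm, ← Finset.sum_neg_distrib]
        congr 1
        · simp
        · refine Finset.sum_congr rfl fun n _ => ?_
          rw [intervalIntegral.integral_const_mul, mul_left_comm (Real.Gamma α)⁻¹, hJ n ht.1]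
          have := (hGn n).ne'
          have := (hGn (n + 1)).ne'
          field_simp
          ring
      have hdiff : y t - S (N + 1) t = -(lam * ((Real.Gamma α)⁻¹ *
          ∫ s in (0 : ℝ)..t, (t - s) ^ (α - 1) * (y s - S N s))) := by
        simp_rw [mul_sub]
        rw [hSsucc, heq t ht, intervalIntegral.integral_sub iy iS]
        ring
      rw [hdiff, abs_neg, abs_mul, abs_mul, abs_of_pos hlam, abs_of_pos (inv_pos.mpr hG)]
      have hle : |∫ s in (0 : ℝ)..t, (t - s) ^ (α - 1) * (y s - S N s)|
          ≤ ∫ s in (0 : ℝ)..t, M * lam ^ N / Real.Gamma (α * N + 1)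
            * ((t - s) ^ (α - 1) * s ^ (α * N)) := by
        rw [← Real.norm_eq_abs]
        refine intervalIntegral.norm_integral_le_of_norm_le ht.1.le
          (Eventually.of_forall fun s hs => ?_) ((iJ N ht.1).const_mul _)
        have hk : 0 ≤ (t - s) ^ (α - 1) := Real.rpow_nonneg (by linarith [hs.2]) _
        rw [norm_mul, Real.norm_of_nonneg hk, Real.norm_eq_abs]
        refine (mul_le_mul_of_nonneg_left (ih s ⟨hs.1, hs.2.trans ht.2⟩) hk).trans_eq ?_
        ring
      calc lam * ((Real.Gamma α)⁻¹ * |∫ s in (0 : ℝ)..t, (t - s) ^ (α - 1) * (y s - S N s)|)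
          ≤ lam * ((Real.Gamma α)⁻¹ * ∫ s in (0 : ℝ)..t, M * lam ^ N / Real.Gamma (α * N + 1)
            * ((t - s) ^ (α - 1) * s ^ (α * N))) := by gcongr
        _ = _ := by
          rw [intervalIntegral.integral_const_mul, mul_left_comm (Real.Gamma α)⁻¹, hJ N ht.1]
          have := (hGn N).ne'
          have := (hGn (N + 1)).ne'
          field_simp
          ring
  have hterm : ∀ (x : ℝ) (n : ℕ), (x * t ^ α) ^ n / Real.Gamma (α * n + 1)
      = x ^ n / Real.Gamma (α * n + 1) * t ^ (α * n) := by
    intro x n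
    rw [mul_pow, ← Real.rpow_mul_natCast ht0.le]
    ring
  have hlim0 : Tendsto (fun N : ℕ => M * lam ^ N / Real.Gamma (α * N + 1) * t ^ (α * N)) atTop
      (𝓝 0) := by
    have := (summable_mittagLeffler h0 (lam * t ^ α)).tendsto_atTop_zero.const_mul M
    simp_rw [hterm] at this
    rw [mul_zero] at this
    refine this.congr fun N => ?_
    ring
  have hlimS : Tendsto (fun N => S N t) atTop (𝓝 (y t)) := by
    rw [tendsto_iff_norm_sub_tendsto_zero]
    refine squeeze_zero (fun _ => norm_nonneg _) (fun N => ?_) hlim0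
    rw [norm_sub_rev]
    exact hbound N t ⟨ht0, ht.2⟩
  have hlimS' : Tendsto (fun N => S N t) atTop (𝓝 (y 0 * mittagLeffler α 1 (-lam * t ^ α))) := by
    have := (summable_mittagLeffler h0 (-lam * t ^ α)).hasSum.tendsto_sum_nat.const_mul (y 0)
    refine this.congr fun N => ?_
    rw [hS, Finset.mul_sum]
    refine Finset.sum_congr rfl fun n _ => ?_
    rw [hterm]
    ring
  exact tendsto_nhds_unique hlimS hlimS'

/-- Subtracting the equilibrium `c / lam` makes the relaxation equation homogeneous. -/
theorem eq_mittagLeffler_of_hasCaputoDeriv {α q lam c : ℝ} (h0 : 0 < α) (h1 : α ≤ 1)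
    (hlam : 0 < lam) {v v' : ℝ → ℝ} (hvc : ContinuousOn v (Icc 0 q))
    (hv : ∀ t ∈ Ioc 0 q, HasDerivWithinAt v (v' t) (Ioc 0 q) t)
    (hv' : ContinuousOn v' (Ioc 0 q))
    (hcap : ∀ t ∈ Ioc 0 q, HasCaputoDeriv α v' t (c - lam * v t)) {t : ℝ} (ht : t ∈ Icc 0 q) :
    v t = c / lam + (v 0 - c / lam) * mittagLeffler α 1 (-lam * t ^ α) := by
  have hw : ContinuousOn (fun t => c - lam * v t) (Icc 0 q) :=
    continuousOn_const.sub (continuousOn_const.mul hvc)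
  have key := eq_mittagLeffler_of_integral_eq (y := fun t => v t - c / lam) h0 hlam
    (hvc.sub continuousOn_const) (fun t ht => ?_) ht
  · linarith
  · have h := sub_eq_of_hasCaputoDeriv h0 h1 hvc hv hv' hw hcap ht
    have e : ∀ s, (t - s) ^ (α - 1) * (c - lam * v s)
        = -lam * ((t - s) ^ (α - 1) * (v s - c / lam)) := fun s => by
      field_simp
      ring
    simp_rw [e] at h
    rw [intervalIntegral.integral_const_mul] at h
    linarith

/-! ### The wave equation -/

theorem eq_cos_sub_sin_of_wave {p lam c : ℝ} (hlam : 0 < lam) {y y' : ℝ → ℝ}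
    (hy : ∀ t ∈ Icc (-p) 0, HasDerivWithinAt y (y' t) (Icc (-p) 0) t)
    (hy'c : ContinuousOn y' (Icc (-p) 0))
    (hy' : ∀ t ∈ Ioo (-p) 0, HasDerivAt y' (c - lam * y t) t)
    (h0 : y' 0 = c - lam * y 0) {t : ℝ} (ht : t ∈ Icc (-p) 0) :
    y t = c / lam + (y 0 - c / lam) * (Real.cos (√lam * t) - √lam * Real.sin (√lam * t)) := by
  set μ := √lam with hμ
  have hμ0 : 0 < μ := Real.sqrt_pos.mpr hlam
  have hμ2 : lam = μ * μ := (Real.mul_self_sqrt hlam.le).symm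
  rcases ht.2.eq_or_lt with rfl | htneg
  · simp
  -- A conserved quantity: at `s = t` it is `y t - c / lam`, and at `s = 0` it contains only the
  -- data at 0, with `y' 0` supplied by the gluing relation `h0`.
  set F : ℝ → ℝ := fun s =>
    (y s - c / lam) * Real.cos (μ * (s - t)) - y' s / μ * Real.sin (μ * (s - t)) with hF
  have hyc : ContinuousOn y (Icc (-p) 0) := fun s hs => (hy s hs).continuousWithinAt
  have hsub : Icc t 0 ⊆ Icc (-p) 0 := Icc_subset_Icc_left ht.1
  have hFc : ContinuousOn F (Icc t 0) := by
    refine (((hyc.mono hsub).sub continuousOn_const).mul ?_).sub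
      (((hy'c.mono hsub).div_const μ).mul ?_) <;> fun_prop
  have hFd : ∀ s ∈ Ioo t 0, HasDerivAt F 0 s := by
    intro s hs
    have hs' : s ∈ Ioo (-p) 0 := ⟨ht.1.trans_lt hs.1, hs.2⟩
    have d1 : HasDerivAt y (y' s) s :=
      (hy s (Ioo_subset_Icc_self hs')).hasDerivAt (Icc_mem_nhds hs'.1 hs'.2)
    have d0 : HasDerivAt (fun s => μ * (s - t)) μ s := by
      simpa using ((hasDerivAt_id s).sub_const t).const_mul μ
    have := ((d1.sub_const (c / lam)).mul d0.cos).sub (((hy' s hs').div_const μ).mul d0.sin)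
    convert! this using 1
    rw [hμ2]
    field_simp
    ring
  obtain ⟨_, _, hslope⟩ := exists_hasDerivAt_eq_slope F (fun _ => 0) htneg hFc hFd
  have hFF : F t = F 0 := by
    rw [eq_comm, div_eq_zero_iff] at hslope
    rcases hslope with h | h <;> linarith
  simp only [hF, sub_self, mul_zero, Real.cos_zero, Real.sin_zero, mul_one, sub_zero, zero_sub,
    mul_neg, Real.cos_neg, Real.sin_neg, h0] at hFF
  have e : (c - lam * y 0) / μ = -(μ * (y 0 - c / lam)) := by
    rw [hμ2]
    field_simp
    ring
  rw [e] at hFF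
  linarith

/-! ### Modes of a solution -/

/-- For each `ε > 0` the integrand is integrable and the functional passes under the integral;
continuity handles the limit. -/
theorem HasCaputoDeriv.clm_apply {E : Type*} [NormedAddCommGroup E] [NormedSpace ℝ E]
    [CompleteSpace E] {α q t : ℝ} {v' : ℝ → E} {w : E} (L : E →L[ℝ] ℝ)
    (hv' : ContinuousOn v' (Ioc 0 q)) (ht : t ∈ Ioc 0 q) (h : HasCaputoDeriv α v' t w) :
    HasCaputoDeriv α (fun s => L (v' s)) t (L w) := by
  refine ⟨fun h1 => by rw [h.1 h1], fun h1 => ?_⟩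
  refine ((L.continuous.tendsto w).comp (h.2 h1)).congr' ?_
  filter_upwards [Ioo_mem_nhdsGT ht.1] with ε hε
  have hint : IntervalIntegrable (fun s => (t - s) ^ (-α) • v' s) volume ε t := by
    refine (intervalIntegrable_sub_rpow (by linarith) _ _ _).smul_continuousOn ?_
    rw [uIcc_of_le hε.2.le]
    exact hv'.mono fun s hs => ⟨hε.1.trans_le hs.1, hs.2.trans ht.2⟩
  rw [Function.comp_apply, map_smul, ← L.intervalIntegral_comp_comm hint]
  simp only [map_smul]

/-- The map `toL2` as a continuous linear map. -/
def toL2L : domain →L[ℝ] L2 := (PiLp.proj 2 (fun _ : Fin 3 => L2) 0) ∘L domain.subtypeL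

theorem toL2L_apply (v : domain) : toL2L v = toL2 v := rfl

section Modes

variable {α p q : ℝ} {g : LInf} {ψ φ : domain} {u : ℝ → domain} {f : L2} {ut utt cu : ℝ → L2}

theorem SolvesWith.apply_neg (h : SolvesWith α p q g ψ φ u f ut utt cu) (hp : 0 < p) (hq : 0 < q) :
    u (-p) = ψ := by
  have h1 : Tendsto u (𝓝[>] (-p)) (𝓝 (u (-p))) :=
    ((h.continuousOn_u (-p) ⟨le_rfl, by linarith⟩).mono_of_mem_nhdsWithin
      (mem_of_superset (Ioc_mem_nhdsGT (by linarith)) Ioc_subset_Icc_self)).tendsto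
  exact tendsto_nhds_unique h1 (tendsto_iff_norm_sub_tendsto_zero.mpr h.initial)

theorem SolvesWith.apply_pos (h : SolvesWith α p q g ψ φ u f ut utt cu) (hp : 0 < p) (hq : 0 < q) :
    u q = φ := by
  have h1 : Tendsto u (𝓝[<] q) (𝓝 (u q)) :=
    ((h.continuousOn_u q ⟨by linarith, le_rfl⟩).mono_of_mem_nhdsWithin
      (mem_of_superset (Ico_mem_nhdsLT (by linarith)) Ico_subset_Icc_self)).tendsto
  exact tendsto_nhds_unique h1 (tendsto_iff_norm_sub_tendsto_zero.mpr h.final)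

/-- `cu` is continuous at 0 from the right and `ut` from the left, so gluing becomes an equality of
values; `ut 0` is the left derivative. -/
theorem SolvesWith.cu_zero (h : SolvesWith α p q g ψ φ u f ut utt cu) (hp : 0 < p) (hq : 0 < q) :
    cu 0 = ut 0 := by
  have h1 : Tendsto cu (𝓝[>] 0) (𝓝 (cu 0)) :=
    ((h.continuousOn_cu 0 ⟨le_rfl, hq.le⟩).mono_of_mem_nhdsWithin
      (mem_of_superset (Ioc_mem_nhdsGT hq) Ioc_subset_Icc_self)).tendsto
  have h2 : Tendsto ut (𝓝[<] 0) (𝓝 (ut 0)) :=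
    ((h.continuousOn_ut_neg 0 ⟨by linarith, le_rfl⟩).mono_of_mem_nhdsWithin
      (mem_of_superset (Ico_mem_nhdsLT (by linarith)) Ico_subset_Icc_self)).tendsto
  have h3 : Tendsto (fun τ : ℝ => -τ) (𝓝[>] 0) (𝓝[<] 0) := by
    simpa using tendsto_neg_nhdsGT (a := (0 : ℝ))
  have h4 := (h1.sub (h2.comp h3)).norm
  exact sub_eq_zero.mp (norm_eq_zero.mp (tendsto_nhds_unique h4 h.gluing))

variable {lam : ℝ} {e : domain}

/-- For `t ≥ 0` the component of a solution along an eigenfunction relaxes to `f / lam`. -/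
theorem SolvesWith.mode_pos (h : SolvesWith α p q g ψ φ u f ut utt cu) (hα₀ : 0 < α) (hα₁ : α ≤ 1)
    (hp : 0 < p) (hlam : 0 < lam)
    (he : ∀ v, inner ℝ (sturmLiouville g v) (toL2 e) = -(lam * inner ℝ (toL2 v) (toL2 e)))
    {t : ℝ} (ht : t ∈ Icc 0 q) :
    inner ℝ (toL2 (u t)) (toL2 e) = inner ℝ f (toL2 e) / lam
      + (inner ℝ (toL2 (u 0)) (toL2 e) - inner ℝ f (toL2 e) / lam)
        * mittagLeffler α 1 (-lam * t ^ α) := by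
  let L : L2 →L[ℝ] ℝ := innerSL ℝ (toL2 e)
  have hL : ∀ v, L v = inner ℝ v (toL2 e) := fun v => by
    rw [innerSL_apply_apply, real_inner_comm]
  refine eq_mittagLeffler_of_hasCaputoDeriv (v := fun t => inner ℝ (toL2 (u t)) (toL2 e))
    (v' := fun t => inner ℝ (ut t) (toL2 e)) hα₀ hα₁ hlam ?_ (fun t ht => ?_) ?_
    (fun t ht => ?_) ht
  · simp_rw [← hL, ← toL2L_apply]
    exact L.continuous.comp_continuousOn (toL2L.continuous.comp_continuousOn
      (h.continuousOn_u.mono (Icc_subset_Icc_left (by linarith))))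
  · simp_rw [← hL]
    exact L.hasFDerivAt.comp_hasDerivWithinAt t (h.hasDeriv_pos t ht)
  · simp_rw [← hL]
    exact L.continuous.comp_continuousOn h.continuousOn_ut_pos
  · have h1 := (h.hasCaputoDeriv t ht).clm_apply L h.continuousOn_ut_pos ht
    have h2 := h.diffusion t (Ioc_subset_Icc_self ht) e
    rw [he] at h2
    simp_rw [hL] at h1
    rwa [show inner ℝ (cu t) (toL2 e) = inner ℝ f (toL2 e)
      - lam * inner ℝ (toL2 (u t)) (toL2 e) by linarith] at h1

/-- For `t ≤ 0` the component of a solution along an eigenfunction oscillates about `f / lam`. -/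
theorem SolvesWith.mode_neg (h : SolvesWith α p q g ψ φ u f ut utt cu)
    (hp : 0 < p) (hq : 0 < q) (hlam : 0 < lam)
    (he : ∀ v, inner ℝ (sturmLiouville g v) (toL2 e) = -(lam * inner ℝ (toL2 v) (toL2 e)))
    {t : ℝ} (ht : t ∈ Icc (-p) 0) :
    inner ℝ (toL2 (u t)) (toL2 e) = inner ℝ f (toL2 e) / lam
      + (inner ℝ (toL2 (u 0)) (toL2 e) - inner ℝ f (toL2 e) / lam)
        * (Real.cos (√lam * t) - √lam * Real.sin (√lam * t)) := by
  let L : L2 →L[ℝ] ℝ := innerSL ℝ (toL2 e)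
  have hL : ∀ v, L v = inner ℝ v (toL2 e) := fun v => by
    rw [innerSL_apply_apply, real_inner_comm]
  refine eq_cos_sub_sin_of_wave (y := fun t => inner ℝ (toL2 (u t)) (toL2 e))
    (y' := fun t => inner ℝ (ut t) (toL2 e)) hlam (fun t ht => ?_) ?_ (fun t ht => ?_) ?_ ht
  · simp_rw [← hL]
    exact L.hasFDerivAt.comp_hasDerivWithinAt t (h.hasDeriv_neg t ht)
  · simp_rw [← hL]
    exact L.continuous.comp_continuousOn h.continuousOn_ut_neg
  · have h1 : HasDerivAt (fun s => L (ut s)) (L (utt t)) t :=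
      L.hasFDerivAt.comp_hasDerivAt t (h.hasDeriv_ut t ht)
    have h2 := h.wave t ht e
    rw [he] at h2
    simp_rw [hL] at h1
    rwa [show inner ℝ (utt t) (toL2 e) = inner ℝ f (toL2 e)
      - lam * inner ℝ (toL2 (u t)) (toL2 e) by linarith] at h1
  -- The diffusion equation at `t = 0` supplies the terminal velocity for the wave equation.
  · have h2 := h.diffusion 0 ⟨le_rfl, hq.le⟩ e
    rw [he, h.cu_zero hp hq] at h2
    linarith

/-- The boundary data determine the amplitude of a mode. -/
theorem SolvesWith.amplitude_mul_discriminant (h : SolvesWith α p q g ψ φ u f ut utt cu)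
    (hα₀ : 0 < α) (hα₁ : α ≤ 1) (hp : 0 < p) (hq : 0 < q) (hlam : 0 < lam)
    (he : ∀ v, inner ℝ (sturmLiouville g v) (toL2 e) = -(lam * inner ℝ (toL2 v) (toL2 e))) :
    (inner ℝ (toL2 (u 0)) (toL2 e) - inner ℝ f (toL2 e) / lam) * discriminant α p q lam
      = inner ℝ (toL2 φ) (toL2 e) - inner ℝ (toL2 ψ) (toL2 e) := by
  have h1 := h.mode_pos hα₀ hα₁ hp hlam he (t := q) ⟨hq.le, le_rfl⟩
  have h2 := h.mode_neg hp hq hlam he (t := -p) ⟨le_rfl, by linarith⟩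
  rw [h.apply_pos hp hq] at h1
  rw [h.apply_neg hp hq, mul_neg, Real.cos_neg, Real.sin_neg] at h2
  rw [h1, h2, discriminant]
  ring

end Modes

end MixedInverse

end

/-! ### Uniqueness for the inverse problem -/

theorem theorem3p1 (α p q : ℝ) (hα₀ : 0 < α) (hα₁ : α ≤ 1) (hp : 0 < p) (hq : 0 < q)
    (g : MixedInverse.LInf) (hg : 0 ≤ g)
    (hΔ : ∀ lam : ℝ, MixedInverse.IsEigenvalue g lam →
      MixedInverse.discriminant α p q lam ≠ 0)
    (ψ φ : MixedInverse.domain) (u₁ u₂ : ℝ → MixedInverse.domain) (f₁ f₂ : MixedInverse.L2)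
    (h₁ : MixedInverse.IsSolution α p q g ψ φ u₁ f₁)
    (h₂ : MixedInverse.IsSolution α p q g ψ φ u₂ f₂) :
    (∀ t ∈ Set.Icc (-p) q, u₁ t = u₂ t) ∧ f₁ = f₂ := by
  obtain ⟨ut₁, utt₁, cu₁, h₁⟩ := h₁
  obtain ⟨ut₂, utt₂, cu₂, h₂⟩ := h₂
  -- The components of both solutions along an eigenfunction agree.
  have modes : ∀ (lam : ℝ) (e : MixedInverse.domain), 0 < lam → MixedInverse.IsEigenvalue g lam →
      (∀ v, inner ℝ (MixedInverse.sturmLiouville g v) (MixedInverse.toL2 e)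
        = -(lam * inner ℝ (MixedInverse.toL2 v) (MixedInverse.toL2 e))) →
      inner ℝ f₁ (MixedInverse.toL2 e) = inner ℝ f₂ (MixedInverse.toL2 e) ∧
      ∀ t ∈ Set.Icc (-p) q, inner ℝ (MixedInverse.toL2 (u₁ t)) (MixedInverse.toL2 e)
        = inner ℝ (MixedInverse.toL2 (u₂ t)) (MixedInverse.toL2 e) := by
    intro lam e hlam heig he
    have a₁ := h₁.amplitude_mul_discriminant hα₀ hα₁ hp hq hlam he
    have a₂ := h₂.amplitude_mul_discriminant hα₀ hα₁ hp hq hlam he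
    -- The data are common to both solutions, so a nonzero discriminant forces equal amplitudes.
    have ha := mul_right_cancel₀ (hΔ lam heig) (a₁.trans a₂.symm)
    have b₁ := h₁.mode_pos hα₀ hα₁ hp hlam he (t := q) ⟨hq.le, le_rfl⟩
    have b₂ := h₂.mode_pos hα₀ hα₁ hp hlam he (t := q) ⟨hq.le, le_rfl⟩
    rw [h₁.apply_pos hp hq, ha] at b₁
    rw [h₂.apply_pos hp hq] at b₂
    -- With equal amplitudes, the common value at `q` leaves only the source terms to compare.
    have hf : inner ℝ f₁ (MixedInverse.toL2 e) / lam = inner ℝ f₂ (MixedInverse.toL2 e) / lam := by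
      linarith
    refine ⟨(div_left_inj' hlam.ne').mp hf, fun t ht => ?_⟩
    rcases le_total 0 t with h | h
    · rw [h₁.mode_pos hα₀ hα₁ hp hlam he ⟨h, ht.2⟩, h₂.mode_pos hα₀ hα₁ hp hlam he ⟨h, ht.2⟩,
        ha, hf]
    · rw [h₁.mode_neg hp hq hlam he ⟨ht.1, h⟩, h₂.mode_neg hp hq hlam he ⟨ht.1, h⟩, ha, hf]
  constructor
  · intro t ht
    -- A nonzero difference would have a nonzero component along some eigenfunction.
    refine MixedInverse.toL2_injective (sub_eq_zero.mp (by_contra fun hne => ?_))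
    obtain ⟨lam, e, hlam, heig, he, hne'⟩ :=
      MixedInverse.exists_eigenfunction_inner_ne_zero hg hne
    rw [inner_sub_left, (modes lam e hlam heig he).2 t ht, sub_self] at hne'
    exact hne' rfl
  · refine sub_eq_zero.mp (by_contra fun hne => ?_)
    obtain ⟨lam, e, hlam, heig, he, hne'⟩ :=
      MixedInverse.exists_eigenfunction_inner_ne_zero hg hne
    rw [inner_sub_left, (modes lam e hlam heig he).1, sub_self] at hne'
    exact hne' rfl
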